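/- **Conventions.** Graphs are in the sense of Serre: a graph $X$ has a set $V_X$ of vertices and a set $\mathbf{E}_X$ of directed edges; each $e\in\mathbf{E}_X$ has an origin $o(e)$, a terminus $t(e)$ and an inverse $\bar e$ with $o(\bar e)=t(e)$, $t(\bar e)=o(e)$ and $\bar{\bar e}=e\neq\bar e$. For a finite graph, $\chi(X)=|V_X|-|\mathbf{E}_X|/2$ and $\kappa(X)$ is the number of spanning trees. A voltage assignment with values in an additive group $G$ is a map $\alpha\colon\mathbf{E}_X\to G$ with $\alpha(\bar e)=-\alpha(e)$. The derived graph $X(G,\alpha)$ has vertices $V_X\times G$ and directed edges $\mathbf{E}_X\times G$, with $o(e,\sigma)=(o(e),\sigma)$, $t(e,\sigma)=(t(e),\sigma+\alpha(e))$ and $\overline{(e,\sigma)}=(\bar e,\sigma+\alpha(e))$. **Theorem.** Let $X$ be a finite connected graph with $\chi(X)\neq 0$, and let $\alpha\colon\mathbf{E}_X\to\mathbb{Z}$ be a voltage assignment such that $X(\mathbb{Z},\alpha)$ is connected. For $n\geq 1$ let $X_n=X(\mathbb{Z}/n\mathbb{Z},\alpha_n)$, where $\alpha_n$ is $\alpha$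 modulo $n$. Let $$\mathcal{I}_\alpha(t)=\det(D_X-A_\alpha(t))\in\mathbb{Z}[t^{\pm1}],$$ where $D_X$ is the diagonal matrix with entries $|\{e: o(e)=v\}|$ $(v\in V_X)$ and $A_\alpha(t)$ has $(u,v)$ entry $\sum_{o(e)=u,\,t(e)=v}t^{\alpha(e)}$. Put $b=-\mathrm{ord}_{t=0}(\mathcal{I}_\alpha)$, $e=\mathrm{ord}_{t=1}(\mathcal{I}_\alpha)$ and $J_\alpha(t)=t^b(t-1)^{-e}\mathcal{I}_\alpha(t)\in\mathbb{Z}[t]$. Fix a prime $p$ and an algebraic closure $\overline{\mathbb{Q}}_p$ of $\mathbb{Q}_p$ with ring of integers $\mathcal{O}_p$, let $|\cdot|_p$ be the absolute value on $\overline{\mathbb{Q}}_p$ (and on its completion $\mathbb{C}_p$) with $|p|_p=1/p$, and let $\mathrm{ord}_p(x)=-\log|x|_p/\log p$. For a nonzero polynomial $g=a\prod_i(t-\beta_i)\in\mathbb{C}_p[t]$ let $m_p(g)=\log\bigl(|a|_p\prod_i\max\{1,|\beta_i|_p\}\bigr)$, and let $\Delta_1(J_\alpha)=\mathrm{Res}(J_\alpha(t),t-1)$.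 Define $$\mu_p=-\frac{m_p(J_\alpha)}{\log p},\qquad c_p=\mathrm{ord}_p(\kappa(X))-\mathrm{ord}_p(\Delta_1(J_\alpha)).$$ Let $\beta_1,\dots,\beta_d\in\overline{\mathbb{Q}}_p$ be the roots of $J_\alpha$ counted with multiplicity and, for $n\geq1$, let $$B_{p,n}=\{\beta\in\overline{\mathbb{Q}}_p: J_\alpha(\beta)=0,\ |\beta|_p=1,\ |\beta^n-1|_p<1\},\qquad \lambda_{p,n}=\#\{j:\beta_j\in B_{p,n}\}+e-1.$$ For $\beta\in\mathcal{O}_p$ with $|\beta|_p=1$ let $\tau(\beta)\in\mathcal{O}_p$ be the Teichmüller lift of the reduction of $\beta$, i.e. the unique root of unity of order prime to $p$ with $|\beta-\tau(\beta)|_p<1$, and put $$s_p(\beta)=\min\{s\in\mathbb{Z}_{\geq0}: p^s(p-1)\,\mathrm{ord}_p(\beta-\tau(\beta))>1\},\qquad r_{p,n}(\beta)=\min(\mathrm{ord}_p(n),s_p(\beta)),$$ $$\nu_{p,n}=\sum_{j:\ \beta_j\in B_{p,n}}\Bigl(\mathrm{ord}_p\bigl(\beta_j^{p^{r_{p,n}(\beta_j)}}-\tau(\beta_j)^{p^{r_{p,n}(\beta_j)}}\bigr)-r_{p,n}(\beta_j)\Bigr).$$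 Then, for every integer $n\geq1$, all the valuations occurring here are finite (that is, $\kappa(X)$, $\kappa(X_n)$, $\Delta_1(J_\alpha)$ and the elements $\beta^{p^{r_{p,n}(\beta)}}-\tau(\beta)^{p^{r_{p,n}(\beta)}}$ with $\beta\in B_{p,n}$ are nonzero), and $$\mathrm{ord}_p(\kappa(X_n))=\mu_p\cdot n+\lambda_{p,n}\cdot\mathrm{ord}_p(n)+\nu_{p,n}+c_p.$$ -/

import Mathlib

noncomputable section

/-! ### Graphs in the sense of Serre -/

/-- A graph in the sense of Serre with vertices `V` and directed edges `E`: every edge has an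
origin, a terminus and an inverse edge, and no edge is its own inverse. -/
structure SerreGraph (V E : Type*) where
  o : E → V
  t : E → V
  inv : E → E
  o_inv : ∀ e, o (inv e) = t e
  t_inv : ∀ e, t (inv e) = o e
  inv_inv : ∀ e, inv (inv e) = e
  inv_ne : ∀ e, inv e ≠ e

namespace SerreGraph

variable {V E : Type*}

/-- `X.Reachable T u v`: there is a (possibly empty) path from `u` to `v` in `X` all of whose
directed edges lie in `T`. -/
def Reachable (X : SerreGraph V E) (T : Set E) : V → V → Prop :=
  Relation.ReflTransGen fun u v => ∃ e ∈ T, X.o e = u ∧ X.t e = v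

/-- The spanning subgraph of `X` with set of directed edges `T` is connected. -/
def ConnectedBy (X : SerreGraph V E) (T : Set E) : Prop :=
  Nonempty V ∧ ∀ u v, X.Reachable T u v

/-- `X` is connected. -/
def Connected (X : SerreGraph V E) : Prop :=
  X.ConnectedBy Set.univ

/-- The list of directed edges `c` is a path in `X` (consecutive edges match). -/
def IsPath (X : SerreGraph V E) (c : List E) : Prop :=
  c.IsChain fun e f => X.t e = X.o f

/-- The list of directed edges `c` has no backtracking. -/
def IsReduced (X : SerreGraph V E) (c : List E) : Prop :=
  c.IsChain fun e f => f ≠ X.inv e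

/-- The path `c` is closed: its terminus is its origin. -/
def IsClosedPath (X : SerreGraph V E) (c : List E) : Prop :=
  ∃ hc : c ≠ [], X.IsPath c ∧ X.t (c.getLast hc) = X.o (c.head hc)

/-- The subgraph with directed edges `T` has no circuits: it contains no nonempty
closed path without backtracking. -/
def AcyclicBy (X : SerreGraph V E) (T : Set E) : Prop :=
  ∀ c : List E, (∀ e ∈ c, e ∈ T) → X.IsClosedPath c → ¬ X.IsReduced c

/-- `T` is the set of directed edges of a spanning tree of `X`: it is stable under inversion, and
the subgraph of `X` with all vertices of `X` and directed edges `T` is a tree. -/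
structure IsSpanningTree (X : SerreGraph V E) (T : Set E) : Prop where
  inv_mem : ∀ e ∈ T, X.inv e ∈ T
  connected : X.ConnectedBy T
  acyclic : X.AcyclicBy T

/-- The number `κ(X)` of spanning trees of `X`. -/
def numSpanningTrees (X : SerreGraph V E) : ℕ :=
  Nat.card {T : Set E // X.IsSpanningTree T}

/-- The Euler characteristic `χ(X) = |V| - |E| / 2` (`E` is the set of directed edges). -/
def eulerChar (_X : SerreGraph V E) [Fintype V] [Fintype E] : ℚ :=
  (Fintype.card V : ℚ) - (Fintype.card E : ℚ) / 2

/-- The valency of a vertex: the number of directed edges with origin `v`. -/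
def valency (X : SerreGraph V E) [DecidableEq V] [Fintype E] (v : V) : ℕ :=
  (Finset.univ.filter fun e => X.o e = v).card

end SerreGraph

/-! ### Voltage assignments and derived graphs -/

/-- A voltage assignment on `X` with values in a group `G`, written additively. -/
structure VoltageAssignment {V E : Type*} (X : SerreGraph V E) (G : Type*) [AddGroup G] where
  toFun : E → G
  map_inv : ∀ e, toFun (X.inv e) = - toFun e

namespace VoltageAssignment

variable {V E : Type*} {X : SerreGraph V E} {G H : Type*} [AddGroup G] [AddGroup H]

/-- The composition of a voltage assignment with a group homomorphism. -/
def map (α : VoltageAssignment X G) (f : G →+ H) : VoltageAssignment X H where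
  toFun e := f (α.toFun e)
  map_inv e := by rw [α.map_inv, map_neg]

/-- The derived graph `X(G, α)`. -/
def derived (α : VoltageAssignment X G) : SerreGraph (V × G) (E × G) where
  o e := (X.o e.1, e.2)
  t e := (X.t e.1, e.2 + α.toFun e.1)
  inv e := (X.inv e.1, e.2 + α.toFun e.1)
  o_inv e := by simp [X.o_inv]
  t_inv e := by simp [X.t_inv, α.map_inv]
  inv_inv e := by simp [X.inv_inv, α.map_inv]
  inv_ne e h := X.inv_ne e.1 (congrArg Prod.fst h)

/-- For `α` with values in `ℤ`, the graph `X_n = X(ℤ/nℤ, α mod n)`. -/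
def level (α : VoltageAssignment X ℤ) (n : ℕ) : SerreGraph (V × ZMod n) (E × ZMod n) :=
  (α.map (Int.castAddHom (ZMod n))).derived

/-! ### The Ihara polynomial -/

open scoped LaurentPolynomial in
/-- The Ihara polynomial `det (D_X - A_α(t)) ∈ ℤ[t, t⁻¹]`, where `D_X` is the valency matrix and
the `(u, v)` entry of `A_α(t)` is the sum of `t ^ α(e)` over the edges `e` from `u` to `v`. -/
def ihara [Fintype V] [DecidableEq V] [Fintype E] (α : VoltageAssignment X ℤ) : ℤ[T;T⁻¹] :=
  Matrix.det (Matrix.diagonal (fun v => (X.valency v : ℤ[T;T⁻¹])) -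
    Matrix.of fun u v => ∑ e ∈ Finset.univ.filter (fun e => X.o e = u ∧ X.t e = v),
      LaurentPolynomial.T (α.toFun e))

end VoltageAssignment

/-! ### Clearing denominators and removing the zero at `t = 1` -/

open scoped LaurentPolynomial in
/-- The order of vanishing at `t = 0` of a nonzero Laurent polynomial: the smallest exponent that
occurs in it. -/
def ordAtZero (f : ℤ[T;T⁻¹]) : ℤ := sInf {k : ℤ | f.coeff k ≠ 0}

open scoped LaurentPolynomial in
/-- The polynomial `t ^ b * f` with `b = - ord_{t = 0} f`. -/
def clearPole (f : ℤ[T;T⁻¹]) : Polynomial ℤ :=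
  LaurentPolynomial.trunc (LaurentPolynomial.T (- ordAtZero f) * f)

open scoped LaurentPolynomial in
/-- The order of vanishing at `t = 1` of a nonzero Laurent polynomial. -/
def ordAtOne (f : ℤ[T;T⁻¹]) : ℕ := (clearPole f).rootMultiplicity 1

open scoped LaurentPolynomial in
/-- The polynomial `t ^ b * (t - 1) ^ (-e) * f`, with `b = - ord_{t = 0} f` and
`e = ord_{t = 1} f`. -/
def removeZeros (f : ℤ[T;T⁻¹]) : Polynomial ℤ :=
  clearPole f /ₘ (Polynomial.X - Polynomial.C 1) ^ ordAtOne f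

open scoped LaurentPolynomial in
theorem toLaurent_clearPole (f : ℤ[T;T⁻¹]) :
    Polynomial.toLaurent (clearPole f) = LaurentPolynomial.T (- ordAtZero f) * f := by
  have hbdd : BddBelow {k : ℤ | f.coeff k ≠ 0} := by
    have : {k : ℤ | f.coeff k ≠ 0} = (f.coeff.support : Set ℤ) := by ext k; simp
    rw [this]
    exact f.coeff.support.bddBelow
  have hf : ∀ m : ℤ, LaurentPolynomial.T (- m) * f = ∑ k ∈ f.coeff.support,
      LaurentPolynomial.C (f.coeff k) * LaurentPolynomial.T (k - m) := by
    intro m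
    conv_lhs => rw [← AddMonoidAlgebra.sum_coeff_single f, Finsupp.sum, Finset.mul_sum]
    refine Finset.sum_congr rfl fun k _ => ?_
    rw [LaurentPolynomial.single_eq_C_mul_T, mul_left_comm, ← LaurentPolynomial.T_add,
      neg_add_eq_sub]
  rw [clearPole, hf, map_sum, map_sum]
  refine Finset.sum_congr rfl fun k hk => ?_
  have hle : ordAtZero f ≤ k := csInf_le hbdd (Finsupp.mem_support_iff.mp hk)
  rw [LaurentPolynomial.trunc_C_mul_T, if_pos (by linarith), ← Polynomial.C_mul_X_pow_eq_monomial,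
    Polynomial.toLaurent_C_mul_X_pow, Int.toNat_of_nonneg (by linarith)]

open scoped LaurentPolynomial in
theorem toLaurent_removeZeros (f : ℤ[T;T⁻¹]) :
    (LaurentPolynomial.T 1 - 1) ^ ordAtOne f * Polynomial.toLaurent (removeZeros f) =
      LaurentPolynomial.T (- ordAtZero f) * f := by
  rw [← toLaurent_clearPole,
    ← Polynomial.pow_mul_divByMonic_rootMultiplicity_eq (clearPole f) 1]
  simp [removeZeros, ordAtOne]

/-! ### Pierce-Lehmer sequences and Mahler measures -/

/-- The Pierce-Lehmer sequence `Δ_n(f) = Res(f, t ^ n - 1)`. -/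
def pierceLehmer (f : Polynomial ℤ) (n : ℕ) : ℤ :=
  Polynomial.resultant f (Polynomial.X ^ n - 1)

/-- The `p`-adic Mahler measure of a polynomial over `ℂ_p`. -/
def padicMahler (p : ℕ) [Fact p.Prime] (g : Polynomial ℂ_[p]) : ℝ :=
  ‖g.leadingCoeff‖ * (g.roots.map fun β => max 1 ‖β‖).prod

/-- The logarithmic `p`-adic Mahler measure. -/
def logPadicMahler (p : ℕ) [Fact p.Prime] (g : Polynomial ℂ_[p]) : ℝ :=
  Real.log (padicMahler p g)

/-! ### The `p`-adic valuation and Teichmüller lifts -/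

/-- The valuation `ord_p` of a nonzero element of an algebraic closure of `ℚ_p`, normalized by
`ord_p(p) = 1`. -/
def ordPadic (p : ℕ) [Fact p.Prime] (x : PadicAlgCl p) : ℝ :=
  - Real.log ‖x‖ / Real.log p

/-- The ring of integers of an algebraic closure of `ℚ_p`. -/
abbrev padicAlgInt (p : ℕ) [Fact p.Prime] : ValuationSubring (PadicAlgCl p) :=
  (PadicAlgCl.valued p).v.valuationSubring

/-- The residue field of the ring of integers of an algebraic closure of `ℚ_p`. -/
abbrev padicResidueField (p : ℕ) [Fact p.Prime] : Type :=
  IsLocalRing.ResidueField (padicAlgInt p)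

section Teichmuller

variable (p : ℕ) [hp : Fact p.Prime]

theorem mem_padicAlgInt {x : PadicAlgCl p} : x ∈ padicAlgInt p ↔ ‖x‖ ≤ 1 := Iff.rfl

theorem residue_eq_zero_iff_norm (x : padicAlgInt p) :
    IsLocalRing.residue (padicAlgInt p) x = 0 ↔ ‖(x : PadicAlgCl p)‖ < 1 := by
  have h1 : ‖(x : PadicAlgCl p)‖ ≤ 1 := x.2
  rw [IsLocalRing.residue_eq_zero_iff, IsLocalRing.mem_maximalIdeal, mem_nonunits_iff, not_iff_comm,
    not_lt]
  constructor
  · intro h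
    have hx : (x : PadicAlgCl p) ≠ 0 := by
      intro h0; rw [h0, norm_zero] at h; linarith
    have hi : (x : PadicAlgCl p)⁻¹ ∈ padicAlgInt p := by
      rw [mem_padicAlgInt, norm_inv]; exact inv_le_one_of_one_le₀ h
    exact IsUnit.of_mul_eq_one ⟨_, hi⟩ (Subtype.ext (mul_inv_cancel₀ hx))
  · rintro ⟨u, rfl⟩
    have h2 : ‖((u⁻¹ : (padicAlgInt p)ˣ) : padicAlgInt p).1‖ ≤ 1 := (u⁻¹).1.2
    have h3 : ((u : padicAlgInt p) : PadicAlgCl p) * ((u⁻¹ : (padicAlgInt p)ˣ) : padicAlgInt p).1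
        = 1 := congrArg Subtype.val u.mul_inv
    have h4 := congrArg norm h3
    rw [norm_mul, norm_one] at h4
    nlinarith [norm_nonneg ((u : padicAlgInt p) : PadicAlgCl p)]

theorem residue_natCast_prime : ((p : ℕ) : padicResidueField p) = 0 := by
  have h : IsLocalRing.residue (padicAlgInt p) (p : padicAlgInt p) = 0 := by
    rw [residue_eq_zero_iff_norm]
    have h2 := PadicAlgCl.valuation_p p
    have h3 : ‖(p : PadicAlgCl p)‖ = 1 / p := by
      rw [← PadicAlgCl.valuation_coe, h2]; simp
    have h4 : ((p : padicAlgInt p) : PadicAlgCl p) = p := by simp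
    rw [h4, h3, one_div]
    exact inv_lt_one_of_one_lt₀ (by exact_mod_cast hp.out.one_lt)
  simpa using h

instance padicResidueField_charP : CharP (padicResidueField p) p :=
  (CharP.charP_iff_prime_eq_zero hp.out).mpr (residue_natCast_prime p)

/-- Every nonzero element of the residue field has finite order prime to `p`. -/
theorem padicResidueField_exists_pow_eq_one (x : padicResidueField p) (hx : x ≠ 0) :
    ∃ m : ℕ, m.Coprime p ∧ x ^ m = 1 := by
  obtain ⟨β, rfl⟩ := IsLocalRing.residue_surjective x
  -- the reduction map on `ℤ_p`
  let ψ : ℤ_[p] →+* padicAlgInt p :=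
    ((algebraMap ℚ_[p] (PadicAlgCl p)).comp PadicInt.Coe.ringHom).codRestrict
      (padicAlgInt p).toSubring fun z => by
        change ‖algebraMap ℚ_[p] (PadicAlgCl p) (z : ℚ_[p])‖ ≤ 1
        simpa using z.norm_le_one
  let φ : ℤ_[p] →+* padicResidueField p := (IsLocalRing.residue (padicAlgInt p)).comp ψ
  let _ : Algebra (ZMod p) (padicResidueField p) := ZMod.algebra _ p
  have hφ : φ = (algebraMap (ZMod p) (padicResidueField p)).comp PadicInt.toZMod := by
    refine RingHom.ext fun z => ?_
    have hz := PadicInt.sub_zmodRepr_mem z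
    rw [PadicInt.maximalIdeal_eq_span_p, Ideal.mem_span_singleton] at hz
    obtain ⟨w, hw⟩ := hz
    have : z = z.zmodRepr + p * w := by rw [← hw]; ring
    rw [this]
    have h0 : ((p : ℕ) : padicResidueField p) = 0 := residue_natCast_prime p
    simp only [map_add, map_mul, map_natCast, RingHom.comp_apply, h0]
    simp
  have hint : IsIntegral ℚ_[p] (β : PadicAlgCl p) :=
    (PadicAlgCl.isAlgebraic p).isAlgebraic _ |>.isIntegral
  have hmon := minpoly.monic hint
  have hcoef : ∀ n, ‖(minpoly ℚ_[p] (β : PadicAlgCl p)).coeff n‖ ≤ 1 := by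
    rw [← spectralValue_le_one_iff hmon]
    exact β.2
  have hlift : minpoly ℚ_[p] (β : PadicAlgCl p) ∈ Polynomial.lifts (PadicInt.Coe.ringHom (p := p)) := by
    rw [Polynomial.lifts_iff_coeff_lifts]
    intro n
    exact ⟨⟨_, hcoef n⟩, rfl⟩
  obtain ⟨P, hP, -, hPm⟩ := Polynomial.lifts_and_natDegree_eq_and_monic hlift hmon
  have hroot : Polynomial.eval₂ ψ β P = 0 := by
    apply Subtype.ext
    have h1 : ((Polynomial.eval₂ ψ β P : padicAlgInt p) : PadicAlgCl p) =
        Polynomial.eval₂ ((algebraMap ℚ_[p] (PadicAlgCl p)).comp PadicInt.Coe.ringHom) (β : PadicAlgCl p) P :=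
      Polynomial.hom_eval₂ P ψ (padicAlgInt p).subtype β
    rw [h1, ← Polynomial.eval₂_map, hP]
    exact minpoly.aeval _ _
  have halg : IsAlgebraic (ZMod p) (IsLocalRing.residue (padicAlgInt p) β) := by
    refine ⟨P.map PadicInt.toZMod, (hPm.map _).ne_zero, ?_⟩
    rw [Polynomial.aeval_def, Polynomial.eval₂_map, ← hφ, ← Polynomial.hom_eval₂, hroot, map_zero]
  set x := IsLocalRing.residue (padicAlgInt p) β
  let F := IntermediateField.adjoin (ZMod p) {x}
  have : FiniteDimensional (ZMod p) F :=
    IntermediateField.adjoin.finiteDimensional halg.isIntegral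
  have : Finite F := Module.finite_of_finite (ZMod p)
  have := Fintype.ofFinite F
  let y : F := ⟨x, IntermediateField.mem_adjoin_simple_self _ x⟩
  have hy : y ≠ 0 := fun h => hx (congrArg Subtype.val h)
  refine ⟨Fintype.card F - 1, ?_, ?_⟩
  · have : CharP F p := charP_of_injective_algebraMap (algebraMap (ZMod p) F).injective p
    obtain ⟨k, -, hk⟩ := FiniteField.card F p
    rw [hk]
    have h1 : 1 ≤ p ^ (k : ℕ) := Nat.one_le_pow _ _ hp.out.pos
    refine Nat.Coprime.symm ((Nat.Prime.coprime_iff_not_dvd hp.out).mpr fun h => ?_)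
    have h2 : p ∣ p ^ (k : ℕ) := dvd_pow_self p k.ne_zero
    have h3 := (Nat.dvd_sub_iff_right h1 h2).mp h
    exact hp.out.one_lt.ne' (Nat.dvd_one.mp h3)
  · exact congrArg Subtype.val (FiniteField.pow_card_sub_one_eq_one y hy)

/-- Every nonzero element of the residue field is the reduction of a unique root of unity
whose order is prime to `p`. -/
theorem existsUnique_teichmuller (x : padicResidueField p) (hx : x ≠ 0) :
    ∃! ξ : padicAlgInt p, IsLocalRing.residue (padicAlgInt p) ξ = x ∧
      ∃ m : ℕ, m.Coprime p ∧ ξ ^ m = 1 := by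
  obtain ⟨m, hm, hxm⟩ := padicResidueField_exists_pow_eq_one p x hx
  have pos : ∀ {m : ℕ}, m.Coprime p → 0 < m := by
    intro m hm
    rcases Nat.eq_zero_or_pos m with h | h
    · rw [h, Nat.coprime_zero_left] at hm; exact absurd hm hp.out.one_lt.ne'
    · exact h
  obtain ⟨β, rfl⟩ := IsLocalRing.residue_surjective x
  -- existence
  have hex : ∃ ξ : padicAlgInt p, IsLocalRing.residue (padicAlgInt p) ξ =
      IsLocalRing.residue (padicAlgInt p) β ∧ ξ ^ m = 1 := by
    have hlt : ‖(β : PadicAlgCl p) ^ m - 1‖ < 1 := by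
      have := (residue_eq_zero_iff_norm p (β ^ m - 1)).mp (by rw [map_sub, map_pow, hxm]; simp)
      simpa using this
    have hsplit := IsAlgClosed.splits (Polynomial.X ^ m - 1 : Polynomial (PadicAlgCl p))
    have hmonic : (Polynomial.X ^ m - 1 : Polynomial (PadicAlgCl p)).Monic := by
      simpa using Polynomial.monic_X_pow_sub_C (1 : PadicAlgCl p) (pos hm).ne'
    have hprod := hsplit.eq_prod_roots
    rw [hmonic.leadingCoeff, Polynomial.C_1, one_mul] at hprod
    have hev := congrArg (Polynomial.eval (β : PadicAlgCl p)) hprod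
    rw [Polynomial.eval_multiset_prod, Multiset.map_map] at hev
    simp only [Polynomial.eval_sub, Polynomial.eval_pow, Polynomial.eval_X, Polynomial.eval_one,
      Function.comp_def, Polynomial.eval_C] at hev
    by_contra hno
    push Not at hno
    have hroots : ∀ ζ ∈ (Polynomial.X ^ m - 1 : Polynomial (PadicAlgCl p)).roots,
        1 ≤ ‖(β : PadicAlgCl p) - ζ‖ := by
      intro ζ hζ
      have hζm : ζ ^ m = 1 := by
        have := (Polynomial.mem_roots'.mp hζ).2
        simpa [Polynomial.IsRoot, sub_eq_zero] using this
      have hn : ‖ζ‖ = 1 := by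
        have h := congrArg norm hζm
        rw [norm_pow, norm_one] at h
        exact (pow_eq_one_iff_of_nonneg (norm_nonneg ζ) (pos hm).ne').mp h
      by_contra hlt'
      rw [not_le] at hlt'
      refine hno ⟨ζ, (mem_padicAlgInt p).mpr hn.le⟩ ?_ (Subtype.ext hζm)
      rw [eq_comm, ← sub_eq_zero, ← map_sub, residue_eq_zero_iff_norm]
      exact hlt'
    have hge : ∀ s : Multiset (PadicAlgCl p), (∀ ζ ∈ s, 1 ≤ ‖(β : PadicAlgCl p) - ζ‖) →
        1 ≤ ‖(s.map fun ζ => (β : PadicAlgCl p) - ζ).prod‖ := by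
      intro s
      induction s using Multiset.induction_on with
      | empty => intro _; simp
      | cons a s ih =>
        intro h
        rw [Multiset.map_cons, Multiset.prod_cons, norm_mul]
        exact one_le_mul_of_one_le_of_one_le (h a (Multiset.mem_cons_self a s))
          (ih fun ζ hζ => h ζ (Multiset.mem_cons_of_mem hζ))
    have := hge _ hroots
    rw [← hev] at this
    linarith
  obtain ⟨ξ, hξ, hξm⟩ := hex
  refine ⟨ξ, ⟨hξ, m, hm, hξm⟩, ?_⟩
  rintro η ⟨hη, m', hm', hηm⟩
  -- uniqueness
  set M := m' * m with hM
  have hMc : M.Coprime p := Nat.Coprime.mul_left hm' hm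
  have h1 : η ^ M - ξ ^ M = 0 := by
    rw [hM, pow_mul, hηm, mul_comm, pow_mul, hξm]; simp
  rw [← (Commute.all η ξ).geom_sum₂_mul M] at h1
  rcases mul_eq_zero.mp h1 with h | h
  · exfalso
    have h2 := congrArg (IsLocalRing.residue (padicAlgInt p)) h
    rw [map_sum, map_zero] at h2
    simp only [map_mul, map_pow, hη, hξ] at h2
    rw [Finset.sum_congr rfl (g := fun _ => (IsLocalRing.residue (padicAlgInt p) β) ^ (M - 1))
      (fun i hi => by
        rw [← pow_add]; congr 1
        have := Finset.mem_range.mp hi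
        omega), Finset.sum_const, Finset.card_range, nsmul_eq_mul] at h2
    rcases mul_eq_zero.mp h2 with h3 | h3
    · have := (CharP.cast_eq_zero_iff (padicResidueField p) p M).mp h3
      exact (Nat.Prime.coprime_iff_not_dvd hp.out).mp hMc.symm this
    · exact pow_ne_zero _ hx h3
  · exact sub_eq_zero.mp h

open Classical in
/-- The Teichmüller lift: `0` lifts to `0`, and a nonzero element of the residue field lifts to
the unique root of unity of order prime to `p` which reduces to it. -/
def teichmullerLift (x : padicResidueField p) : padicAlgInt p :=
  if hx : x = 0 then 0 else (existsUnique_teichmuller p x hx).choose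

end Teichmuller

open Classical in
/-- The reduction `π_p(β)` of `β` modulo the maximal ideal of the ring of integers
(set to `0` when `β` is not integral). -/
def padicReduction (p : ℕ) [Fact p.Prime] (β : PadicAlgCl p) : padicResidueField p :=
  if h : β ∈ padicAlgInt p then IsLocalRing.residue (padicAlgInt p) ⟨β, h⟩ else 0

/-- `τ_p(π_p(β))`, as an element of the algebraic closure of `ℚ_p`. -/
def teichmullerRep (p : ℕ) [Fact p.Prime] (β : PadicAlgCl p) : PadicAlgCl p :=
  (teichmullerLift p (padicReduction p β) : PadicAlgCl p)

/-- `s_p(β)`, the least `s ≥ 0` with `p ^ s * (p - 1) * ord_p(β - τ_p(π_p(β))) > 1`. -/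
def sPadic (p : ℕ) [Fact p.Prime] (β : PadicAlgCl p) : ℕ :=
  sInf {s : ℕ | 1 < (p : ℝ) ^ s * ((p : ℝ) - 1) * ordPadic p (β - teichmullerRep p β)}

/-- `r_{p,n}(β) = min (ord_p n, s_p β)`. -/
def rPadic (p : ℕ) [Fact p.Prime] (n : ℕ) (β : PadicAlgCl p) : ℕ :=
  min (padicValNat p n) (sPadic p β)

/-! ### The invariants of a `ℤ`-tower -/

namespace VoltageAssignment

variable {V E : Type*} {X : SerreGraph V E} [Fintype V] [DecidableEq V] [Fintype E]

/-- The polynomial `J_α(t) = t ^ b * (t - 1) ^ (-e) * I_α(t)`. -/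
def J (α : VoltageAssignment X ℤ) : Polynomial ℤ := removeZeros α.ihara

/-- `μ_p(X, α) = - m_p(J_α) / log p`. -/
def mu (α : VoltageAssignment X ℤ) (p : ℕ) [Fact p.Prime] : ℝ :=
  - logPadicMahler p (α.J.map (Int.castRingHom ℂ_[p])) / Real.log p

/-- `c_p(X, α) = ord_p(κ(X)) - ord_p(Δ_1(J_α))`. -/
def c (α : VoltageAssignment X ℤ) (p : ℕ) [Fact p.Prime] : ℝ :=
  (padicValNat p X.numSpanningTrees : ℝ) - (padicValInt p (pierceLehmer α.J 1) : ℝ)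

/-- The set `B_{p,n}(X, α)` of the roots `β` of `J_α` with `|β| = 1` and `|β ^ n - 1| < 1`. -/
def B (α : VoltageAssignment X ℤ) (p : ℕ) [Fact p.Prime] (n : ℕ) : Set (PadicAlgCl p) :=
  {β | Polynomial.aeval β α.J = 0 ∧ ‖β‖ = 1 ∧ ‖β ^ n - 1‖ < 1}

open Classical in
/-- The roots of `J_α`, counted with multiplicity, which lie in `B_{p,n}(X, α)`. -/
def rootsB (α : VoltageAssignment X ℤ) (p : ℕ) [Fact p.Prime] (n : ℕ) :
    Multiset (PadicAlgCl p) :=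
  (α.J.aroots (PadicAlgCl p)).filter fun β => β ∈ α.B p n

/-- `λ_{p,n}(X, α)`: the number of roots of `J_α` in `B_{p,n}(X, α)`, plus `e - 1`. -/
def lam (α : VoltageAssignment X ℤ) (p : ℕ) [Fact p.Prime] (n : ℕ) : ℤ :=
  ((α.rootsB p n).card : ℤ) + (ordAtOne α.ihara : ℤ) - 1

/-- `ν_{p,n}(X, α)`. -/
def nu (α : VoltageAssignment X ℤ) (p : ℕ) [Fact p.Prime] (n : ℕ) : ℝ :=
  ((α.rootsB p n).map fun β =>
    ordPadic p (β ^ p ^ rPadic p n β - teichmullerRep p β ^ p ^ rPadic p n β) -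
      (rPadic p n β : ℝ)).sum

end VoltageAssignment

end

/-! The Fourier transform on `ZMod n` block-diagonalises the Laplacian of `X_n`, with one block for
each `n`-th root of unity `ζ`. The matrix-tree theorem then gives `n κ(X_n) = κ(X) ∏_{ζ ≠ 1} I_α(ζ)`
(`natCast_mul_numSpanningTrees_level`). At a root of unity the power of `t` separating `I_α` from
`(t - 1)^e J_α` has absolute value 1, the factors `1 - ζ` multiply to `n`, and a further factor
`J_α(1)` completes the product of the `J_α(ζ)` to all `n`-th roots of unity. With `a` the leading
coefficient and `β` running over the roots of `J_α`, this reads `|n| |κ(X_n)| |J_α(1)| = |κ(X)|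
|n|^e |a|^n ∏ |β^n - 1|` (`norm_numSpanningTrees_level`).

What remains is local at each root (`log_norm_pow_sub_one`). If `|β| ≠ 1`, then `|β^n - 1| = max(1,
|β|)^n`; together with `|a|^n` this is the Mahler measure, hence `μ_p n`. If `|β| = 1` and `β` is
not in `B_{p,n}`, the factor is 1. If `β` is in `B_{p,n}`, then `u = β / τ(β)` is a principal unit
with `u^n = β^n`. Exponents prime to `p` do not change the distance to 1, and a `p`-th power
multiplies it by `|p|` once `|u - 1|^(p-1) < |p|`; `s_p(β)` successive `p`-th powers suffice to get
there. So the valuation is `ord_p(n)` plus the summand of `ν_{p,n}` (`ordPadic_pow_sub_one`).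
Finally `Δ_1(J_α) = ± J_α(1)` accounts for `c_p`.

All valuations are finite because each `X_n` is connected and so has a spanning tree; by the
displayed identity no root of `J_α` is then an `n`-th root of unity.

The matrix-tree theorem comes from expanding a determinant over all choices of one outgoing edge at
each vertex other than a root: arborescences contribute 1, other choices 0, and arborescences with a
fixed root correspond to spanning trees. -/

namespace SerreGraph

variable {V E : Type*}

/-! ### Arborescences -/

/-- `f` chooses an edge out of every vertex other than `r`, and following the chosen edges leads
to `r`, as witnessed by a height function. -/
def IsArborescence (X : SerreGraph V E) (r : V) (f : V → Option E) : Prop :=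
  f r = none ∧ ∃ h : V → ℕ, ∀ v, v ≠ r → ∃ e, f v = some e ∧ X.o e = v ∧ h (X.t e) < h v

/-- The edges chosen by `f` and their inverses. -/
def chosenEdges (X : SerreGraph V E) (f : V → Option E) : Set E :=
  {e | f (X.o e) = some e ∨ f (X.t e) = some (X.inv e)}

theorem inv_mem_chosenEdges (X : SerreGraph V E) (f : V → Option E) (e : E)
    (he : e ∈ X.chosenEdges f) : X.inv e ∈ X.chosenEdges f := by
  rcases he with h | h
  · right; rw [X.t_inv, X.inv_inv]; exact h
  · left; rw [X.o_inv]; exact h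

theorem Reachable.symm {X : SerreGraph V E} {T : Set E} (hT : ∀ e ∈ T, X.inv e ∈ T) {u v : V}
    (h : X.Reachable T u v) : X.Reachable T v u := by
  induction h with
  | refl => exact .refl
  | tail _ hbc ih =>
    obtain ⟨e, he, rfl, rfl⟩ := hbc
    exact .head ⟨X.inv e, hT e he, X.o_inv e, X.t_inv e⟩ ih

theorem connectedBy_of_reachable {X : SerreGraph V E} {T : Set E} (hT : ∀ e ∈ T, X.inv e ∈ T)
    (r : V) (h : ∀ v, X.Reachable T v r) : X.ConnectedBy T :=
  ⟨⟨r⟩, fun u v => (h u).trans ((h v).symm hT)⟩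

theorem IsArborescence.reachable {X : SerreGraph V E} {r : V} {f : V → Option E}
    (hf : X.IsArborescence r f) (v : V) : X.Reachable (X.chosenEdges f) v r := by
  obtain ⟨-, h, hh⟩ := hf
  induction hv : h v using Nat.strong_induction_on generalizing v with
  | _ n ih =>
    by_cases hvr : v = r
    · rw [hvr]; exact .refl
    · obtain ⟨e, he, hoe, hlt⟩ := hh v hvr
      exact .head ⟨e, Or.inl (by rw [hoe]; exact he), hoe, rfl⟩ (ih _ (hv ▸ hlt) _ rfl)

/-- Heights fall along a chosen edge and rise along its inverse, and a reduced path that has begun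
to rise keeps rising, since the only chosen edge at the vertex reached leads back. A reduced closed
path therefore starts downwards and ends upwards. Its first edge and the inverse of its last are
then both the edge chosen at the base vertex; deleting the two leaves a shorter reduced closed path,
whence the induction on length. -/
theorem IsArborescence.acyclicBy {X : SerreGraph V E} {r : V} {f : V → Option E}
    (hf : X.IsArborescence r f) : X.AcyclicBy (X.chosenEdges f) := by
  obtain ⟨h0, h, hh⟩ := id hf
  have hdown : ∀ e, f (X.o e) = some e → h (X.t e) < h (X.o e) := by
    intro e he
    by_cases hvr : X.o e = r
    · rw [hvr, h0] at he; cases he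
    · obtain ⟨e', he', ho, hlt⟩ := hh _ hvr
      rw [he] at he'; cases he'; exact hlt
  have hup : ∀ e, f (X.t e) = some (X.inv e) → h (X.o e) < h (X.t e) := by
    intro e he
    have := hdown (X.inv e) (by rw [X.o_inv]; exact he)
    rwa [X.o_inv, X.t_inv] at this
  -- a reduced path that starts with an inverse chosen edge only climbs
  have climb : ∀ (c : List E) (e : E), (∀ x ∈ e :: c, x ∈ X.chosenEdges f) → X.IsPath (e :: c) →
      X.IsReduced (e :: c) → f (X.t e) = some (X.inv e) →
      h (X.o e) < h (X.t ((e :: c).getLast (by simp))) := by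
    intro c
    induction c with
    | nil => intro e _ _ _ he; simpa using hup e he
    | cons a c ih =>
      intro e hT hP hR he
      have hP' := List.isChain_cons_cons.mp hP
      have hR' := List.isChain_cons_cons.mp hR
      have ha : f (X.t a) = some (X.inv a) := by
        rcases hT a (by simp) with h1 | h1
        · rw [← hP'.1, he] at h1
          exact absurd (Option.some.inj h1).symm hR'.1
        · exact h1
      have := ih a (fun x hx => hT x (List.mem_cons_of_mem _ hx)) hP'.2 hR'.2 ha
      rw [List.getLast_cons (by simp)]
      rw [← hP'.1] at this
      exact (hup e he).trans this
  -- a reduced path that ends with a chosen edge only descends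
  have descend : ∀ (c : List E) (e : E), (∀ x ∈ e :: c, x ∈ X.chosenEdges f) →
      X.IsPath (e :: c) → X.IsReduced (e :: c) →
      f (X.o ((e :: c).getLast (by simp))) = some ((e :: c).getLast (by simp)) →
      f (X.o e) = some e ∧ h (X.t ((e :: c).getLast (by simp))) < h (X.o e) := by
    intro c
    induction c with
    | nil => intro e _ _ _ he; exact ⟨he, by simpa using hdown e he⟩
    | cons a c ih =>
      intro e hT hP hR he
      have hP' := List.isChain_cons_cons.mp hP
      have hR' := List.isChain_cons_cons.mp hR
      rw [List.getLast_cons (by simp)] at he ⊢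
      obtain ⟨h1, h2⟩ := ih a (fun x hx => hT x (List.mem_cons_of_mem _ hx)) hP'.2 hR'.2
        (by simpa using he)
      have hed : f (X.o e) = some e := by
        rcases hT e (by simp) with h3 | h3
        · exact h3
        · rw [hP'.1, h1] at h3
          exact absurd (Option.some.inj h3) hR'.1
      refine ⟨hed, ?_⟩
      rw [← hP'.1] at h2
      exact h2.trans (hdown e hed)
  intro c
  induction hn : c.length using Nat.strong_induction_on generalizing c with
  | _ n ih =>
    rintro hT ⟨hc, hP, hcl⟩ hR
    obtain ⟨e, c', rfl⟩ := List.exists_cons_of_ne_nil hc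
    have hfirst : f (X.o e) = some e := by
      rcases hT e (by simp) with h1 | h1
      · exact h1
      · have := climb c' e hT hP hR h1
        rw [hcl, List.head_cons] at this
        exact absurd this (lt_irrefl _)
    rcases List.eq_nil_or_concat c' with rfl | ⟨m, e', rfl⟩
    · have := hdown e hfirst
      simp only [List.getLast_singleton, List.head_cons] at hcl
      rw [hcl] at this
      exact absurd this (lt_irrefl _)
    have hlast : (e :: m.concat e').getLast (by simp) = e' := by simp
    rw [hlast, List.head_cons] at hcl
    have hl : f (X.t e') = some (X.inv e') := by
      rcases hT e' (by simp) with h1 | h1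
      · have := (descend _ e hT hP hR (by rw [hlast]; exact h1)).2
        rw [hlast, hcl] at this
        exact absurd this (lt_irrefl _)
      · exact h1
    have hee : X.inv e' = e := by
      rw [hcl, hfirst] at hl
      exact (Option.some.inj hl).symm
    rw [List.concat_eq_append] at *
    rcases m with _ | ⟨a, m⟩
    · have := (List.isChain_cons_cons.mp hR).1
      apply this
      rw [← hee, X.inv_inv]
    · have hP1 : X.IsPath (a :: m ++ [e']) := (List.isChain_cons_cons.mp hP).2
      have hR1 : X.IsReduced (a :: m ++ [e']) := (List.isChain_cons_cons.mp hR).2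
      have hP2 := List.isChain_append.mp hP1
      have hR2 := List.isChain_append.mp hR1
      refine ih (a :: m).length (by rw [← hn]; simp) (a :: m) rfl
        (fun x hx => hT x (by simp only [List.mem_cons, List.mem_append] at hx ⊢; tauto))
        ⟨by simp, hP2.1, ?_⟩ hR2.1
      have h1 := hP2.2.2 _ (List.getLast_mem_getLast? (by simp)) e' (by simp)
      have h2 : X.t e = X.o a := (List.isChain_cons_cons.mp hP).1
      rw [h1, List.head_cons, ← h2, ← hee, X.t_inv]

theorem IsArborescence.isSpanningTree {X : SerreGraph V E} {r : V} {f : V → Option E}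
    (hf : X.IsArborescence r f) : X.IsSpanningTree (X.chosenEdges f) where
  inv_mem := X.inv_mem_chosenEdges f
  connected := connectedBy_of_reachable (X.inv_mem_chosenEdges f) r hf.reachable
  acyclic := hf.acyclicBy

/-- Induction on the height for `f`. If `g` used the edge `e = f v` only in the opposite direction,
the induction hypothesis at `t e` would make `f` choose `inv e` there, and the heights of `v` and `t
e` would each be less than the other. -/
theorem IsArborescence.eq_of_chosenEdges_subset {X : SerreGraph V E} {r : V} {f g : V → Option E}
    (hf : X.IsArborescence r f) (hg : X.IsArborescence r g)
    (h : X.chosenEdges f ⊆ X.chosenEdges g) : f = g := by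
  obtain ⟨f0, hf', hh⟩ := id hf
  have key : ∀ n v, hf' v = n → f v = g v := by
    intro n
    induction n using Nat.strong_induction_on with
    | _ n ih =>
      rintro v rfl
      by_cases hv : v = r
      · rw [hv, f0, hg.1]
      obtain ⟨e, he, ho, hlt⟩ := hh v hv
      rcases h (show e ∈ X.chosenEdges f from Or.inl (by rw [ho]; exact he)) with h1 | h1
      · rw [he, ← h1, ho]
      · exfalso
        have h2 := ih _ hlt (X.t e) rfl
        rw [h1] at h2
        by_cases hw : X.t e = r
        · rw [hw, f0] at h2; cases h2
        · obtain ⟨e', he', -, hlt'⟩ := hh _ hw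
          rw [h2] at he'; cases he'
          rw [X.t_inv, ho] at hlt'
          exact absurd hlt (not_lt.mpr hlt'.le)
  exact funext fun v => key _ v rfl

/-- Every vertex that can be reached can be reached by a path without backtracking. -/
theorem Reachable.exists_isReduced {X : SerreGraph V E} {T : Set E} {u v : V}
    (h : X.Reachable T u v) : u = v ∨ ∃ (e : E) (c : List E), (∀ x ∈ e :: c, x ∈ T) ∧
      X.IsPath (e :: c) ∧ X.IsReduced (e :: c) ∧ X.o e = u ∧
      X.t ((e :: c).getLast (by simp)) = v := by
  induction h using Relation.ReflTransGen.head_induction_on with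
  | refl => left; rfl
  | @head a b hab _ ih =>
    obtain ⟨e, he, rfl, rfl⟩ := hab
    rcases ih with rfl | ⟨e', c, hT, hP, hR, ho, ht⟩
    · right
      exact ⟨e, [], by simpa using he, List.isChain_singleton _, List.isChain_singleton _, rfl, by simp⟩
    -- Prepending `e` either keeps the path reduced or cancels against its first edge, leaving the
    -- tail.
    by_cases hee : e' = X.inv e
    · rcases c with _ | ⟨a, c⟩
      · left
        rw [← ht, List.getLast_singleton, hee, X.t_inv]
      · right
        refine ⟨a, c, fun x hx => hT x (List.mem_cons_of_mem _ hx),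
          (List.isChain_cons_cons.mp hP).2, (List.isChain_cons_cons.mp hR).2, ?_, ?_⟩
        · rw [← (List.isChain_cons_cons.mp hP).1, hee, X.t_inv]
        · rw [← ht]; simp
    · right
      refine ⟨e, e' :: c, ?_, List.isChain_cons_cons.mpr ⟨ho.symm, hP⟩,
        List.isChain_cons_cons.mpr ⟨hee, hR⟩, rfl, ?_⟩
      · intro x hx
        rcases List.mem_cons.mp hx with rfl | hx
        · exact he
        · exact hT x hx
      · rw [← ht]; simp

/-- Breadth-first search: the height is the distance to `r` inside `T`, and each vertex chooses an
edge that decreases it. -/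
theorem exists_isArborescence {X : SerreGraph V E} {T : Set E} (hT : X.ConnectedBy T) (r : V) :
    ∃ f, X.IsArborescence r f ∧ ∀ v e, f v = some e → e ∈ T := by
  classical
  let step : V → V → Prop := fun u v => ∃ e ∈ T, X.o e = u ∧ X.t e = v
  -- `P n v` says that a path of exactly `n` edges of `T` leads from `v` to `r`.
  let P : ℕ → V → Prop := fun n v => Nat.rec (motive := fun _ => V → Prop) (fun v => v = r)
    (fun _ q v => ∃ w, step v w ∧ q w) n v
  have hP : ∀ v, ∃ n, P n v := by
    intro v
    have h : X.Reachable T v r := hT.2 v r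
    induction h using Relation.ReflTransGen.head_induction_on with
    | refl => exact ⟨0, rfl⟩
    | head hab _ ih =>
      obtain ⟨n, hn⟩ := ih
      exact ⟨n + 1, _, hab, hn⟩
  let h : V → ℕ := fun v => Nat.find (hP v)
  have hstep : ∀ v, v ≠ r → ∃ e ∈ T, X.o e = v ∧ h (X.t e) < h v := by
    intro v hv
    have h1 : P (h v) v := Nat.find_spec (hP v)
    rcases hk : h v with _ | k
    · rw [hk] at h1; exact absurd h1 hv
    · rw [hk] at h1
      obtain ⟨w, ⟨e, he, ho, rfl⟩, hw⟩ := h1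
      exact ⟨e, he, ho, Nat.lt_succ_of_le (Nat.find_min' _ hw)⟩
  choose g hgT hgo hgh using hstep
  refine ⟨fun v => if hv : v = r then none else some (g v hv), ⟨by simp, h, fun v hv => ?_⟩, ?_⟩
  · exact ⟨g v hv, by simp [hv], hgo v hv, hgh v hv⟩
  · intro v e hve
    by_cases hv : v = r
    · simp [hv] at hve
    · simp only [hv, dif_neg, not_false_eq_true, Option.some.injEq] at hve
      exact hve ▸ hgT v hv

/-- A breadth-first arborescence inside `T` exhausts `T`: an edge left over, followed by a reduced
path between its ends along chosen edges, would be a circuit in `T`. -/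
theorem IsSpanningTree.exists_isArborescence {X : SerreGraph V E} {T : Set E}
    (hT : X.IsSpanningTree T) (r : V) : ∃ f, X.IsArborescence r f ∧ X.chosenEdges f = T := by
  obtain ⟨f, hf, hfT⟩ := SerreGraph.exists_isArborescence hT.connected r
  have hsub : X.chosenEdges f ⊆ T := by
    rintro e (he | he)
    · exact hfT _ _ he
    · have := hT.inv_mem _ (hfT _ _ he)
      rwa [X.inv_inv] at this
  refine ⟨f, hf, hsub.antisymm fun e he => ?_⟩
  by_contra hne
  have hreach := hf.isSpanningTree.connected.2 (X.t e) (X.o e)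
  rcases hreach.exists_isReduced with heq | ⟨e', c, hcT, hP, hR, ho, ht⟩
  · exact hT.acyclic [e] (by simpa using he)
      ⟨by simp, List.isChain_singleton _, by simpa using heq⟩ (List.isChain_singleton _)
  · refine hT.acyclic (e :: e' :: c) ?_ ⟨by simp, List.isChain_cons_cons.mpr ⟨ho.symm, hP⟩, ?_⟩
      (List.isChain_cons_cons.mpr ⟨?_, hR⟩)
    · intro x hx
      rcases List.mem_cons.mp hx with rfl | hx
      · exact he
      · exact hsub (hcT x hx)
    · rw [List.head_cons, ← ht]; simp
    · rintro rfl
      refine hne ?_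
      have := X.inv_mem_chosenEdges f _ (hcT (X.inv e) (by simp))
      rwa [X.inv_inv] at this

/-- Spanning trees correspond to arborescences with a given root. -/
theorem numSpanningTrees_eq_card_arborescence (X : SerreGraph V E) (r : V) :
    X.numSpanningTrees = Nat.card {f : V → Option E // X.IsArborescence r f} := by
  refine (Nat.card_congr (Equiv.ofBijective
    (fun f : {f : V → Option E // X.IsArborescence r f} =>
      (⟨X.chosenEdges f.1, f.2.isSpanningTree⟩ : {T : Set E // X.IsSpanningTree T})) ⟨?_, ?_⟩)).symm
  · intro f g hfg
    exact Subtype.ext (f.2.eq_of_chosenEdges_subset g.2 (congrArg Subtype.val hfg).subset)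
  · rintro ⟨T, hT⟩
    obtain ⟨f, hf, hfT⟩ := hT.exists_isArborescence r
    exact ⟨⟨f, hf⟩, Subtype.ext hfT⟩

theorem Connected.numSpanningTrees_ne_zero [Finite V] [Finite E] {X : SerreGraph V E}
    (hX : X.Connected) : X.numSpanningTrees ≠ 0 := by
  obtain ⟨r⟩ := hX.1
  obtain ⟨f, hf, -⟩ := SerreGraph.exists_isArborescence hX r
  rw [X.numSpanningTrees_eq_card_arborescence r]
  have : Nonempty {f : V → Option E // X.IsArborescence r f} := ⟨⟨f, hf⟩⟩
  exact Nat.card_pos.ne'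

end SerreGraph

namespace SerreGraph

variable {V E : Type*} [DecidableEq V]

/-! ### The matrix-tree theorem -/

/-- The Laplacian matrix of a graph with weighted adjacency matrix. -/
def weightedLaplacian {R : Type*} [Ring R] [Fintype E] (X : SerreGraph V E) (w : E → R) :
    Matrix V V R :=
  Matrix.diagonal (fun v => (X.valency v : R)) -
    Matrix.of fun u v => ∑ e ∈ Finset.univ.filter (fun e => X.o e = u ∧ X.t e = v), w e

/-- The row which a choice of an edge out of `v`, or of none, contributes to the Laplacian. -/
def choiceRow (X : SerreGraph V E) (v : V) (e : Option E) : V → ℤ :=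
  e.elim (Pi.single v 1) fun e => Pi.single v 1 - Pi.single (X.t e) 1

theorem weightedLaplacian_row [Fintype E] (X : SerreGraph V E) (v : V) :
    X.weightedLaplacian (fun _ => (1 : ℤ)) v =
      ∑ e ∈ Finset.univ.filter (fun e => X.o e = v), X.choiceRow v (some e) := by
  ext w
  simp only [weightedLaplacian, choiceRow, Matrix.sub_apply, Matrix.of_apply, Option.elim_some,
    Finset.sum_apply, Pi.sub_apply, Finset.sum_sub_distrib]
  congr 1
  · rw [Finset.sum_const, Matrix.diagonal_apply, Pi.single_apply]
    by_cases h : v = w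
    · simp [h, valency]
    · simp [h, Ne.symm h]
  · rw [← Finset.filter_filter, Finset.sum_filter]
    exact Finset.sum_congr rfl fun e _ => by simp [Pi.single_apply, eq_comm]

variable [Fintype V]

/-- The next vertex. -/
def next (X : SerreGraph V E) (f : V → Option E) (v : V) : V := (f v).elim v X.t

theorem choiceRow_mulVec (X : SerreGraph V E) (f : V → Option E) (x : V → ℤ) (v : V) :
    (Matrix.of fun v => X.choiceRow v (f v)).mulVec x v =
      if f v = none then x v else x v - x (X.next f v) := by
  change X.choiceRow v (f v) ⬝ᵥ x = _
  rw [choiceRow, next]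
  rcases f v with _ | e
  · simp
  · simp [sub_dotProduct]

/-- The matrix is `1 - N`, where `N` moves each vertex one step towards `r` and kills the coordinate
at `r`. Heights strictly decrease, so `N` is nilpotent. -/
theorem IsArborescence.det_choiceRow {X : SerreGraph V E} {r : V} {f : V → Option E}
    (hf : X.IsArborescence r f) : (Matrix.of fun v => X.choiceRow v (f v)).det = 1 := by
  obtain ⟨h0, h, hh⟩ := hf
  set N : Matrix V V ℤ := 1 - Matrix.of fun v => X.choiceRow v (f v) with hN
  have hNx : ∀ x v, N.mulVec x v = if v = r then 0 else x (X.next f v) := by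
    intro x v
    rw [hN, Matrix.sub_mulVec, Pi.sub_apply, Matrix.one_mulVec, choiceRow_mulVec]
    by_cases hv : v = r
    · simp [hv, h0]
    · obtain ⟨e, he, -, -⟩ := hh v hv
      simp [hv, he]
  have hpow : ∀ k x v, h v < k → (N ^ k).mulVec x v = 0 := by
    intro k
    induction k with
    | zero => intro x v hv; exact absurd hv (Nat.not_lt_zero _)
    | succ k ih =>
      intro x v hv
      rw [pow_succ', ← Matrix.mulVec_mulVec, hNx]
      split_ifs with hvr
      · rfl
      · obtain ⟨e, he, -, hlt⟩ := hh v hvr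
        have : X.next f v = X.t e := by rw [next, he]; rfl
        rw [this]
        exact ih x _ (by omega)
  have hnil : IsNilpotent N := by
    refine ⟨Finset.univ.sup h + 1, ?_⟩
    refine Matrix.mulVec_injective (funext fun x => funext fun v => ?_)
    rw [hpow _ x v (Nat.lt_succ_of_le (Finset.le_sup (Finset.mem_univ v))), Matrix.zero_mulVec]
    rfl
  -- Over `ℤ` the characteristic polynomial of a nilpotent matrix is exactly a power of the
  -- variable; its value at 1 is `det (1 - N)`.
  have hchar := Matrix.isNilpotent_charpoly_sub_pow_of_isNilpotent hnil
  have hdet := Matrix.eval_charpoly N 1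
  rw [sub_eq_zero.mp hchar.eq_zero] at hdet
  rw [Polynomial.eval_pow, Polynomial.eval_X, one_pow] at hdet
  rw [hdet, hN]
  congr 1
  simp

/-- Unless all orbits of `next` reach `r`, the indicator function of the vertices whose orbit avoids
`r` is a nonzero vector in the kernel. If all do, the number of steps to `r` is a height function.
-/
theorem det_choiceRow_eq_zero {X : SerreGraph V E} {r : V} {f : V → Option E}
    (h0 : f r = none) (hf : ∀ v ≠ r, ∃ e, f v = some e ∧ X.o e = v)
    (hna : ¬ X.IsArborescence r f) : (Matrix.of fun v => X.choiceRow v (f v)).det = 0 := by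
  classical
  have hr : ∃ v, ∀ k, (X.next f)^[k] v ≠ r := by
    by_contra! hall
    refine hna ⟨h0, fun v => Nat.find (hall v), fun v hv => ?_⟩
    obtain ⟨e, he, ho⟩ := hf v hv
    refine ⟨e, he, ho, ?_⟩
    change Nat.find (hall (X.t e)) < Nat.find (hall v)
    have h1 := Nat.find_spec (hall v)
    rcases hk : Nat.find (hall v) with _ | k
    · rw [hk] at h1; exact absurd h1 hv
    · rw [hk, Function.iterate_succ_apply, show X.next f v = X.t e by rw [next, he]; rfl] at h1
      exact Nat.lt_succ_of_le (Nat.find_min' (hall (X.t e)) h1)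
  obtain ⟨v₀, hv₀⟩ := hr
  rw [← Matrix.exists_mulVec_eq_zero_iff]
  refine ⟨fun v => if ∀ k, (X.next f)^[k] v ≠ r then 1 else 0, ?_, ?_⟩
  · intro h
    have := congrFun h v₀
    simp [hv₀] at this
  · funext v
    rw [choiceRow_mulVec]
    by_cases hv : v = r
    · subst hv
      rw [if_pos h0, if_neg]
      · rfl
      · push Not; exact ⟨0, rfl⟩
    · obtain ⟨e, he, -⟩ := hf v hv
      rw [if_neg (by simp [he]), Pi.zero_apply, sub_eq_zero]
      congr 1
      refine propext ⟨fun h k => ?_, fun h k => ?_⟩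
      · have := h (k + 1); rwa [Function.iterate_succ_apply] at this
      · rcases k with _ | k
        · exact hv
        · rw [Function.iterate_succ_apply]; exact h k

/-- Each row is a sum of choice rows over the edges leaving its vertex, and row `r` is the choice
row of `none`. Multilinearity makes the determinant a sum over choice functions, in which exactly
the arborescences count, each with weight 1. -/
theorem det_updateRow_weightedLaplacian [Fintype E] (X : SerreGraph V E) (r : V) :
    ((X.weightedLaplacian fun _ => (1 : ℤ)).updateRow r (Pi.single r 1)).det =
      X.numSpanningTrees := by
  classical
  let A : V → Finset (Option E) := fun v =>
    if v = r then {none} else (Finset.univ.filter fun e => X.o e = v).map ⟨some, Option.some_injective _⟩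
  have hrows : (X.weightedLaplacian fun _ => (1 : ℤ)).updateRow r (Pi.single r 1) =
      fun v => ∑ e ∈ A v, X.choiceRow v e := by
    funext v
    by_cases hv : v = r
    · subst hv
      simp [A, choiceRow]
    · rw [Matrix.updateRow_ne hv, weightedLaplacian_row]
      simp [A, hv]
  have hA : ∀ f : V → Option E, f ∈ Fintype.piFinset A ↔
      f r = none ∧ ∀ v ≠ r, ∃ e, f v = some e ∧ X.o e = v := by
    intro f
    rw [Fintype.mem_piFinset]
    constructor
    · intro h
      refine ⟨by simpa [A] using h r, fun v hv => ?_⟩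
      have := h v
      simp only [A, hv, if_false, Finset.mem_map, Finset.mem_filter, Finset.mem_univ, true_and] at this
      obtain ⟨e, ho, he⟩ := this
      exact ⟨e, he.symm, ho⟩
    · rintro ⟨h0, h⟩ v
      by_cases hv : v = r
      · simp [A, hv, h0]
      · obtain ⟨e, he, ho⟩ := h v hv
        simp [A, hv, he, ho]
  have hexp := (Matrix.detRowAlternating (n := V) (R := ℤ)).toMultilinearMap.map_sum_finset
    (fun v e => X.choiceRow v e) A
  have hterm : ∀ f ∈ Fintype.piFinset A, (Matrix.of fun v => X.choiceRow v (f v)).det =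
      if X.IsArborescence r f then 1 else 0 := by
    intro f hf
    rw [hA] at hf
    split_ifs with h
    · exact h.det_choiceRow
    · exact det_choiceRow_eq_zero hf.1 hf.2 h
  rw [hrows]
  refine hexp.trans ((Finset.sum_congr rfl hterm).trans ?_)
  rw [Finset.sum_boole, X.numSpanningTrees_eq_card_arborescence r]
  congr 1
  rw [Nat.card_eq_fintype_card, Fintype.card_subtype]
  congr 1
  ext f
  simp only [Finset.mem_filter, Finset.mem_univ, true_and, and_iff_right_iff_imp]
  rintro ⟨h0, h, hh⟩
  exact (hA f).mpr ⟨h0, fun v hv => (hh v hv).imp fun e he => ⟨he.1, he.2.1⟩⟩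

theorem weightedLaplacian_mulVec_one [Fintype E] (X : SerreGraph V E) :
    (X.weightedLaplacian fun _ => (1 : ℤ)).mulVec 1 = 0 := by
  funext v
  rw [Matrix.mulVec, weightedLaplacian_row, sum_dotProduct]
  exact Finset.sum_eq_zero fun e _ => by simp [choiceRow, sub_dotProduct]

-- Edge inversion exchanges the edges from `u` to `v` with those from `v` to `u`.
omit [Fintype V] in
theorem weightedLaplacian_transpose [Fintype E] (X : SerreGraph V E) :
    (X.weightedLaplacian fun _ => (1 : ℤ)).transpose = X.weightedLaplacian fun _ => (1 : ℤ) := by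
  rw [weightedLaplacian, Matrix.transpose_sub, Matrix.diagonal_transpose]
  congr 1
  ext u v
  rw [Matrix.transpose_apply, Matrix.of_apply, Matrix.of_apply]
  refine Finset.sum_bij' (fun e _ => X.inv e) (fun e _ => X.inv e) ?_ ?_ ?_ ?_ ?_ <;>
    simp +contextual [X.o_inv, X.t_inv, X.inv_inv]

/-- The matrix-tree theorem, for the perturbation of the Laplacian by a matrix of rank one with
constant entries. -/
theorem det_weightedLaplacian_add_const [Fintype E] (X : SerreGraph V E) [Nonempty V] (c : ℤ) :
    (X.weightedLaplacian (fun _ => (1 : ℤ)) + Matrix.of fun _ _ => c).det =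
      c * (Fintype.card V : ℤ) ^ 2 * X.numSpanningTrees := by
  obtain ⟨r⟩ := ‹Nonempty V›
  set M := X.weightedLaplacian fun _ => (1 : ℤ) with hM
  have hM1 : M.mulVec 1 = 0 := X.weightedLaplacian_mulVec_one
  have hM2 : Matrix.vecMul 1 M = 0 := by
    rw [← Matrix.mulVec_transpose, X.weightedLaplacian_transpose, hM1]
  have hdet0 : M.det = 0 :=
    Matrix.exists_mulVec_eq_zero_iff.mp ⟨1, fun h => one_ne_zero (congrFun h r), hM1⟩
  have hbase : (M + Matrix.vecMulVec (Pi.single r 1) (Pi.single r 1)).det =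
      (X.numSpanningTrees : ℤ) := by
    have : M + Matrix.vecMulVec (Pi.single r 1) (Pi.single r 1) =
        M.updateRow r (M r + Pi.single r 1) := by
      ext u v
      by_cases hu : u = r
      · subst hu; simp [Matrix.vecMulVec_apply]
      · simp [Matrix.vecMulVec_apply, hu]
    rw [this, Matrix.det_updateRow_add, Matrix.updateRow_eq_self, hdet0, zero_add,
      X.det_updateRow_weightedLaplacian]
  have hQ : ∀ u v : V → ℤ, (1 + Matrix.vecMulVec u v).det = 1 + v ⬝ᵥ u := by
    intro u v
    rw [Matrix.vecMulVec_eq Unit, Matrix.det_one_add_replicateCol_mul_replicateRow]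
  let u : V → ℤ := fun _ => c
  -- Constant vectors lie in both the left and the right kernel of `M`. Multiplying by rank-one
  -- perturbations of the identity therefore leaves `M` alone and turns the single entry 1 at `(r,
  -- r)` first into a constant row, then into a constant matrix. The two multipliers have
  -- determinants `c |V|` and `|V|`.
  have hright : (M + Matrix.vecMulVec (Pi.single r 1) (Pi.single r 1)) *
      (1 + Matrix.vecMulVec 1 (u - Pi.single r 1)) = M + Matrix.vecMulVec (Pi.single r 1) u := by
    rw [mul_add, mul_one, add_mul, Matrix.mul_vecMulVec, hM1, Matrix.vecMulVec_mul_vecMulVec]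
    ext a b
    by_cases ha : a = r <;> simp [Matrix.vecMulVec_apply, ha]
  have hleft : (1 + Matrix.vecMulVec (1 - Pi.single r 1) 1) * (M + Matrix.vecMulVec (Pi.single r 1) u) =
      M + Matrix.of fun _ _ => c := by
    rw [add_mul, one_mul, mul_add, Matrix.vecMulVec_mul, hM2, Matrix.vecMulVec_mul_vecMulVec]
    ext a b
    by_cases ha : a = r <;> simp [Matrix.vecMulVec_apply, ha, u]
  rw [← hleft, Matrix.det_mul, ← hright, Matrix.det_mul, hbase, hQ, hQ]
  have h1 : (1 : V → ℤ) ⬝ᵥ (1 - Pi.single r 1) = Fintype.card V - 1 := by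
    simp [dotProduct_sub]
  have h2 : (u - Pi.single r 1) ⬝ᵥ (1 : V → ℤ) = Fintype.card V * c - 1 := by
    simp [u, dotProduct]
  rw [h1, h2]
  ring

end SerreGraph

/-! ### The Fourier transform of the Laplacian of a cyclic cover -/

namespace SerreGraph

variable {V E : Type*} [DecidableEq V] [Fintype E]

/-- Grouping the edges out of `v` by terminus turns the matrix product into a sum over edges, a form
which can be compared between a graph and its cover. -/
theorem weightedLaplacian_mul [Fintype V] {R ι : Type*} [CommRing R] (X : SerreGraph V E)
    (w : E → R) (F : Matrix V ι R) (v : V) (x : ι) :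
    (X.weightedLaplacian w * F) v x =
      ∑ e ∈ Finset.univ.filter (fun e => X.o e = v), (F v x - w e * F (X.t e) x) := by
  rw [weightedLaplacian, Matrix.sub_mul, Matrix.sub_apply, Matrix.diagonal_mul,
    Finset.sum_sub_distrib, Finset.sum_const, nsmul_eq_mul]
  congr 1
  simp only [Matrix.mul_apply, Matrix.of_apply, Finset.sum_mul]
  rw [← Finset.sum_fiberwise_of_maps_to (s := Finset.univ.filter fun e => X.o e = v)
    (t := Finset.univ) (g := X.t) (fun _ _ => Finset.mem_univ _)]
  refine Finset.sum_congr rfl fun u _ => ?_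
  rw [Finset.filter_filter]
  refine Finset.sum_congr rfl fun e he => ?_
  rw [(Finset.mem_filter.mp he).2.2]

theorem weightedLaplacian_map {R S : Type*} [Ring R] [Ring S] (f : R →+* S) (X : SerreGraph V E)
    (w : E → R) : (X.weightedLaplacian w).map f = X.weightedLaplacian fun e => f (w e) := by
  ext u v
  simp only [weightedLaplacian, Matrix.map_apply, Matrix.sub_apply, Matrix.of_apply, map_sub,
    map_sum, Matrix.diagonal_apply]
  congr 1
  split_ifs <;> simp

end SerreGraph

namespace VoltageAssignment

variable {V E : Type*} [Fintype V] [DecidableEq V] [Fintype E] {X : SerreGraph V E}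

open LaurentPolynomial in
theorem eval₂_ihara (α : VoltageAssignment X ℤ) {K : Type*} [CommRing K] (u : Kˣ) :
    eval₂ (Int.castRingHom K) u α.ihara =
      (X.weightedLaplacian fun e => ((u ^ α.toFun e : Kˣ) : K)).det := by
  have : α.ihara = (X.weightedLaplacian fun e => (T (α.toFun e) : LaurentPolynomial ℤ)).det := rfl
  rw [this, RingHom.map_det, RingHom.mapMatrix_apply, SerreGraph.weightedLaplacian_map]
  simp only [eval₂_T]

omit [Fintype V] in
theorem level_sum_outgoing {M : Type*} [AddCommMonoid M] (α : VoltageAssignment X ℤ) (n : ℕ)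
    [NeZero n] (v : V) (a : ZMod n) (F : E × ZMod n → M) :
    ∑ e ∈ Finset.univ.filter (fun e => (α.level n).o e = (v, a)), F e =
      ∑ e ∈ Finset.univ.filter (fun e => X.o e = v), F (e, a) := by
  refine (Finset.sum_nbij' (fun e => (e, a)) (fun e => e.1) ?_ ?_ ?_ ?_ ?_).symm
  · intro e he
    simpa [level, derived] using he
  · rintro ⟨e, b⟩ he
    simp only [level, derived, Finset.mem_filter, Finset.mem_univ, true_and, Prod.mk.injEq] at he ⊢
    exact he.1
  · intro e _; rfl
  · rintro ⟨e, b⟩ he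
    simp only [level, derived, Finset.mem_filter, Finset.mem_univ, true_and, Prod.mk.injEq] at he
    rw [he.2]
  · intro e _; rfl

/-- The unit given by a value of an additive character. -/
def charUnit {K : Type*} [Field K] {n : ℕ} [NeZero n] (ψ : AddChar (ZMod n) K) (j : ZMod n) : Kˣ :=
  Units.mk0 (ψ j) (ψ.val_isUnit j).ne_zero

/-- The number of spanning trees of a cyclic cover is the product of the number of spanning trees
of the base and the special values of the Ihara polynomial at the nontrivial characters. -/
theorem natCast_mul_numSpanningTrees_level [Nonempty V] (α : VoltageAssignment X ℤ) (n : ℕ)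
    [NeZero n] {K : Type*} [Field K] [CharZero K] {ψ : AddChar (ZMod n) K} (hψ : ψ.IsPrimitive) :
    (n : K) * (α.level n).numSpanningTrees = X.numSpanningTrees *
      ∏ j ∈ Finset.univ.erase 0,
        LaurentPolynomial.eval₂ (Int.castRingHom K) (charUnit ψ j) α.ihara := by
  let F : Matrix (V × ZMod n) (V × ZMod n) K :=
    Matrix.kroneckerMap (· * ·) (1 : Matrix V V K) (Matrix.of fun a j => ψ (a * j))
  have hF : ∀ u a v j, F (u, a) (v, j) = if u = v then ψ (a * j) else 0 := by
    intro u a v j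
    simp [F, Matrix.one_apply]
  have hsum : ∀ b : ZMod n, ∑ x, ψ (x * b) = if b = 0 then (n : K) else 0 := by
    intro b
    rw [AddChar.sum_mulShift b hψ, ZMod.card]
    split_ifs <;> simp
  have hFdet : F.det ≠ 0 := by
    rw [Matrix.det_kronecker, Matrix.det_one, one_pow, one_mul]
    refine pow_ne_zero _ ?_
    -- Orthogonality of characters: the inverse Fourier matrix up to the factor `n`, which is
    -- nonzero in characteristic 0.
    have hmul : (Matrix.of fun a j : ZMod n => ψ (a * j)) * (Matrix.of fun a j => ψ (-(a * j))) =
        Matrix.diagonal fun _ => (n : K) := by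
      ext a b
      rw [Matrix.mul_apply, Matrix.diagonal_apply]
      simp only [Matrix.of_apply, ← AddChar.map_add_eq_mul]
      have := hsum (a - b)
      rw [if_congr sub_eq_zero rfl rfl] at this
      rw [← this]
      exact Finset.sum_congr rfl fun x _ => by congr 1; ring
    intro h0
    have := congrArg Matrix.det hmul
    rw [Matrix.det_mul, h0, zero_mul, Matrix.det_diagonal, Finset.prod_const] at this
    exact pow_ne_zero _ (Nat.cast_ne_zero.mpr (NeZero.ne n)) this.symm
  let L : ZMod n → Matrix V V K := fun j =>
    X.weightedLaplacian fun e => ((charUnit ψ j ^ α.toFun e : Kˣ) : K)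
  -- The all-ones matrix added on the cover sums each character over `ZMod n`, so it appears only in
  -- the trivial block, with entries `n`. This makes that block nonsingular and open to the
  -- perturbed matrix-tree theorem with constant `n`.
  let D : ZMod n → Matrix V V K := fun j => L j + Matrix.of fun _ _ => if j = 0 then (n : K) else 0
  have hconj : ((α.level n).weightedLaplacian (fun _ => (1 : K)) + Matrix.of fun _ _ => 1) * F =
      F * Matrix.blockDiagonal D := by
    ext ⟨u, a⟩ ⟨v, j⟩
    have hR : (F * Matrix.blockDiagonal D) (u, a) (v, j) = ψ (a * j) * D j u v := by
      rw [Matrix.mul_apply, Finset.sum_eq_single (u, j)]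
      · rw [hF, if_pos rfl, Matrix.blockDiagonal_apply, if_pos rfl]
      · rintro ⟨w, i⟩ _ hne
        rw [hF, Matrix.blockDiagonal_apply]
        by_cases hw : u = w
        · subst hw
          rw [if_neg (show ¬ i = j by rintro rfl; exact hne rfl), mul_zero]
        · simp [hw]
      · simp
    have hL : L j u v = ∑ e ∈ Finset.univ.filter (fun e => X.o e = u),
        ((if u = v then 1 else 0) - ψ (α.toFun e * j) * if X.t e = v then 1 else 0) := by
      rw [← mul_one (L j), SerreGraph.weightedLaplacian_mul]
      refine Finset.sum_congr rfl fun e _ => ?_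
      rw [Matrix.one_apply, Matrix.one_apply, Units.val_zpow_eq_zpow_val, charUnit, Units.val_mk0,
        ← AddChar.map_zsmul_eq_zpow, zsmul_eq_mul]
    rw [hR, Matrix.add_mul, Matrix.add_apply, SerreGraph.weightedLaplacian_mul,
      α.level_sum_outgoing n u a]
    simp only [D]
    rw [Matrix.add_apply, mul_add, hL, Finset.mul_sum]
    congr 1
    · refine Finset.sum_congr rfl fun e _ => ?_
      simp only [level, derived, map, Int.coe_castAddHom, hF, add_mul, AddChar.map_add_eq_mul]
      split_ifs <;> ring
    · rw [Matrix.mul_apply, Fintype.sum_prod_type, Finset.sum_eq_single v]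
      · simp only [Matrix.of_apply, hF, if_true, one_mul, hsum]
        split_ifs with h
        · simp [h]
        · simp
      · intro w _ hw
        simp [hF, hw]
      · simp
  have hdet := congrArg Matrix.det hconj
  rw [Matrix.det_mul, Matrix.det_mul, mul_comm F.det, Matrix.det_blockDiagonal] at hdet
  replace hdet := mul_right_cancel₀ hFdet hdet
  have hone : ∀ (c : ℤ) {V' E' : Type _} [Fintype V'] [DecidableEq V'] [Nonempty V'] [Fintype E']
      (Y : SerreGraph V' E'), (Y.weightedLaplacian (fun _ => (1 : K)) + Matrix.of fun _ _ => (c : K)).det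
        = c * (Fintype.card V' : K) ^ 2 * Y.numSpanningTrees := by
    intro c V' E' _ _ _ _ Y
    have h := congrArg (Int.castRingHom K) (Y.det_weightedLaplacian_add_const c)
    rw [RingHom.map_det, RingHom.mapMatrix_apply] at h
    simp only [map_mul, map_pow, eq_intCast, Int.cast_natCast] at h
    rw [← h]
    congr 1
    rw [Matrix.map_add _ (by simp), SerreGraph.weightedLaplacian_map]
    simp only [map_one]
    rfl
  have h1 := hone 1 (α.level n)
  have h2 := hone n X
  rw [Int.cast_one] at h1
  rw [h1, ← Finset.mul_prod_erase _ _ (Finset.mem_univ 0)] at hdet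
  have hD0 : D 0 = X.weightedLaplacian (fun _ => (1 : K)) + Matrix.of fun _ _ => ((n : ℤ) : K) := by
    simp [D, L, charUnit]
  rw [hD0, h2] at hdet
  have hDj : ∀ j ∈ Finset.univ.erase (0 : ZMod n), (D j).det =
      LaurentPolynomial.eval₂ (Int.castRingHom K) (charUnit ψ j) α.ihara := by
    intro j hj
    rw [eval₂_ihara]
    congr 1
    have : j ≠ 0 := Finset.ne_of_mem_erase hj
    ext u v
    simp [D, L, this]
  rw [Finset.prod_congr rfl hDj, Fintype.card_prod, ZMod.card] at hdet
  have hn : (n : K) ≠ 0 := Nat.cast_ne_zero.mpr (NeZero.ne n)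
  have hV : (Fintype.card V : K) ≠ 0 := Nat.cast_ne_zero.mpr Fintype.card_ne_zero
  push_cast at hdet
  -- The cover contributes `(|V| n)^2` and the trivial block `n |V|^2`; cancelling the latter leaves
  -- one factor `n` on the left.
  refine mul_left_cancel₀ (mul_ne_zero hn (pow_ne_zero 2 hV)) ?_
  linear_combination hdet

omit [Fintype V] [DecidableEq V] [Fintype E] in
theorem level_connected (α : VoltageAssignment X ℤ) (hα : α.derived.Connected) (n : ℕ) :
    (α.level n).Connected := by
  obtain ⟨⟨v⟩, h⟩ := hα
  refine ⟨⟨(v.1, 0)⟩, ?_⟩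
  rintro ⟨u, a⟩ ⟨w, b⟩
  obtain ⟨a, rfl⟩ := ZMod.intCast_surjective a
  obtain ⟨b, rfl⟩ := ZMod.intCast_surjective b
  refine Relation.ReflTransGen.lift (r := fun u v => ∃ e ∈ Set.univ, α.derived.o e = u ∧
    α.derived.t e = v) (fun x : V × ℤ => (x.1, (x.2 : ZMod n))) ?_ (u, a) (w, b) (h _ _)
  rintro x y ⟨e, -, rfl, rfl⟩
  exact ⟨(e.1, (e.2 : ZMod n)), trivial, rfl, by simp [level, derived, map]⟩

end VoltageAssignment

/-! ### Powers of principal units -/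

section PrincipalUnits

variable {K : Type*} [NormedField K] [IsUltrametricDist K]

theorem norm_eq_of_norm_sub_lt {x y : K} (h : ‖x - y‖ < ‖y‖) : ‖x‖ = ‖y‖ := by
  have := IsUltrametricDist.norm_add_eq_max_of_norm_ne_norm h.ne
  rwa [sub_add_cancel, max_eq_right h.le] at this

theorem norm_sum_lt_one {ι : Type*} (s : Finset ι) (f : ι → K) (h : ∀ i ∈ s, ‖f i‖ < 1) :
    ‖∑ i ∈ s, f i‖ < 1 := by
  classical
  induction s using Finset.induction_on with
  | empty => simp
  | insert a s ha ih =>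
    rw [Finset.sum_insert ha]
    refine (IsUltrametricDist.norm_add_le_max _ _).trans_lt (max_lt (h a (by simp)) (ih ?_))
    exact fun i hi => h i (Finset.mem_insert_of_mem hi)

theorem norm_eq_one_of_norm_sub_one_lt {u : K} (h : ‖u - 1‖ < 1) : ‖u‖ = 1 := by
  rw [norm_eq_of_norm_sub_lt (y := 1) (by rwa [norm_one]), norm_one]

theorem norm_pow_sub_one_lt {u : K} (h : ‖u - 1‖ < 1) (k : ℕ) : ‖u ^ k - 1‖ < 1 := by
  rw [← geom_sum_mul, norm_mul]
  have h1 : ‖∑ i ∈ Finset.range k, u ^ i‖ ≤ 1 :=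
    IsUltrametricDist.norm_sum_le_of_forall_le_of_nonneg zero_le_one fun i _ => by
      rw [norm_pow, norm_eq_one_of_norm_sub_one_lt h, one_pow]
  nlinarith [norm_nonneg (u - 1), norm_nonneg (∑ i ∈ Finset.range k, u ^ i)]

/-- The cofactor `1 + u + ... + u^(m-1)` is congruent to `m`, hence a unit. -/
theorem norm_pow_sub_one_eq {u : K} (h : ‖u - 1‖ < 1) {m : ℕ} (hm : ‖(m : K)‖ = 1) :
    ‖u ^ m - 1‖ = ‖u - 1‖ := by
  rw [← geom_sum_mul, norm_mul]
  have : ‖∑ i ∈ Finset.range m, u ^ i‖ = 1 := by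
    rw [norm_eq_of_norm_sub_lt (y := (m : K)), hm]
    have hs : ∑ i ∈ Finset.range m, u ^ i - (m : K) = ∑ i ∈ Finset.range m, (u ^ i - 1) := by
      simp [Finset.sum_sub_distrib]
    rw [hs, hm]
    exact norm_sum_lt_one _ _ fun i _ => norm_pow_sub_one_lt h i
  rw [this, one_mul]

/-- Binomial expansion of `((u - 1) + 1)^p`: the middle coefficients are divisible by `p`, and after
removing `p * (u - 1)` from those terms the sum is 1 plus multiples of `u - 1`. -/
theorem exists_pow_prime_sub_one_eq {p : ℕ} (hp : p.Prime) {u : K} (h : ‖u - 1‖ < 1) :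
    ∃ S : K, ‖S‖ = 1 ∧ u ^ p - 1 = p * (u - 1) * S + (u - 1) ^ p := by
  refine ⟨∑ k ∈ Finset.Ioo 0 p, (u - 1) ^ (k - 1) * 1 ^ (p - k - 1) * ↑(p.choose k / p), ?_, ?_⟩
  · apply norm_eq_one_of_norm_sub_one_lt
    have h1 : 1 ∈ Finset.Ioo 0 p := by simpa using hp.one_lt
    rw [← Finset.add_sum_erase _ _ h1, Nat.choose_one_right, Nat.div_self hp.pos]
    simp only [Nat.sub_self, pow_zero, one_pow, mul_one, Nat.cast_one,
      add_sub_cancel_left]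
    refine norm_sum_lt_one _ _ fun k hk => ?_
    rw [Finset.mem_erase, Finset.mem_Ioo] at hk
    rw [norm_mul, norm_pow]
    have h2 : ‖u - 1‖ ^ (k - 1) < 1 := pow_lt_one₀ (norm_nonneg _) h (by omega)
    have h3 := IsUltrametricDist.norm_natCast_le_one K (p.choose k / p)
    have h4 : 0 ≤ ‖u - 1‖ ^ (k - 1) := by positivity
    nlinarith [norm_nonneg (((p.choose k / p : ℕ)) : K)]
  · have := add_pow_prime_eq hp (u - 1) 1
    rw [sub_add_cancel] at this
    rw [this]
    ring

/-- Under `hu` the term linear in `p` strictly dominates `(u - 1)^p`. -/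
theorem norm_pow_prime_sub_one_eq {p : ℕ} (hp : p.Prime) {u : K} (h : ‖u - 1‖ < 1)
    (hu : ‖u - 1‖ ^ (p - 1) < ‖(p : K)‖) : ‖u ^ p - 1‖ = ‖(p : K)‖ * ‖u - 1‖ := by
  obtain ⟨S, hS, hSu⟩ := exists_pow_prime_sub_one_eq hp h
  have h1 : u ^ p - 1 = (p * S + (u - 1) ^ (p - 1)) * (u - 1) := by
    rw [hSu, add_mul, ← pow_succ, Nat.sub_add_cancel hp.one_le]; ring
  rw [h1, norm_mul]
  congr 1
  rw [norm_eq_of_norm_sub_lt (y := (p : K) * S), norm_mul, hS, mul_one]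
  rwa [add_sub_cancel_left, norm_pow, norm_mul, hS, mul_one]

theorem norm_pow_prime_sub_one_le {p : ℕ} (hp : p.Prime) {u : K} (h : ‖u - 1‖ < 1) :
    ‖u ^ p - 1‖ ≤ max (‖(p : K)‖ * ‖u - 1‖) (‖u - 1‖ ^ p) := by
  obtain ⟨S, hS, hSu⟩ := exists_pow_prime_sub_one_eq hp h
  rw [hSu]
  refine (IsUltrametricDist.norm_add_le_max _ _).trans ?_
  rw [norm_mul, norm_mul, hS, mul_one, norm_pow]

/-- Enough `p`-th powers bring a principal unit into the disc on which taking `p`-th powers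
multiplies the distance to `1` by `‖p‖`. -/
theorem norm_pow_prime_pow_sub_one_lt {p : ℕ} (hp : p.Prime) (s : ℕ) {u : K} (h : ‖u - 1‖ < 1)
    (hu : ‖u - 1‖ ^ (p ^ s * (p - 1)) < ‖(p : K)‖) : ‖u ^ p ^ s - 1‖ ^ (p - 1) < ‖(p : K)‖ := by
  induction s generalizing u with
  | zero => simpa using hu
  | succ s ih =>
    rw [pow_succ', pow_mul]
    refine ih (norm_pow_sub_one_lt h p) ?_
    have hp1 : ‖(p : K)‖ ≤ 1 := IsUltrametricDist.norm_natCast_le_one K p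
    have hm : p ^ s * (p - 1) ≠ 0 :=
      mul_ne_zero (pow_ne_zero _ hp.ne_zero) (Nat.sub_ne_zero_of_lt hp.one_lt)
    have hp0 : 0 < ‖(p : K)‖ := (pow_nonneg (norm_nonneg (u - 1)) _).trans_lt hu
    -- If the linear term dominates, `u^p` is already within `‖p‖` of 1. Otherwise the distance is
    -- at most `‖u - 1‖^p`, and the extra `p` is absorbed into the exponent of `hu`.
    rcases le_max_iff.mp (norm_pow_prime_sub_one_le hp h) with h1 | h1
    · have h2 : ‖u ^ p - 1‖ < ‖(p : K)‖ := h1.trans_lt (by nlinarith)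
      exact (pow_le_of_le_one (norm_nonneg _) (norm_pow_sub_one_lt h p).le hm).trans_lt h2
    · refine (pow_le_pow_left₀ (norm_nonneg _) h1 _).trans_lt ?_
      rw [← pow_mul, ← mul_assoc, ← pow_succ']
      exact hu

theorem norm_pow_prime_pow_add_sub_one_eq {p : ℕ} (hp : p.Prime) (s j : ℕ) {u : K}
    (h : ‖u - 1‖ < 1) (hu : ‖u - 1‖ ^ (p ^ s * (p - 1)) < ‖(p : K)‖) :
    ‖u ^ p ^ (s + j) - 1‖ = ‖(p : K)‖ ^ j * ‖u ^ p ^ s - 1‖ := by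
  induction j with
  | zero => simp
  | succ j ih =>
    rw [← add_assoc, pow_succ, pow_mul, norm_pow_prime_sub_one_eq hp (norm_pow_sub_one_lt h _), ih,
      pow_succ']
    · ring
    · rw [ih]
      refine lt_of_le_of_lt ?_ (norm_pow_prime_pow_sub_one_lt hp s h hu)
      refine pow_le_pow_left₀ (by positivity) ?_ _
      exact mul_le_of_le_one_left (norm_nonneg _)
        (pow_le_one₀ (norm_nonneg _) (IsUltrametricDist.norm_natCast_le_one K p))

end PrincipalUnits

/-! ### The valuation on the algebraic closure of `ℚ_p` -/

section Valuation

variable (p : ℕ) [hp : Fact p.Prime]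

theorem log_prime_pos : 0 < Real.log p := Real.log_pos (by exact_mod_cast hp.out.one_lt)

theorem ordPadic_mul {x y : PadicAlgCl p} (hx : x ≠ 0) (hy : y ≠ 0) :
    ordPadic p (x * y) = ordPadic p x + ordPadic p y := by
  rw [ordPadic, norm_mul, Real.log_mul (norm_ne_zero_iff.mpr hx) (norm_ne_zero_iff.mpr hy)]
  simp only [ordPadic]; ring

theorem ordPadic_congr {x y : PadicAlgCl p} (h : ‖x‖ = ‖y‖) : ordPadic p x = ordPadic p y := by
  rw [ordPadic, ordPadic, h]

theorem ordPadic_intCast {m : ℤ} (hm : m ≠ 0) :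
    ordPadic p (m : PadicAlgCl p) = padicValInt p m := by
  have h1 : ‖(m : PadicAlgCl p)‖ = (p : ℝ) ^ (-(padicValInt p m : ℤ)) := by
    have h2 : (m : PadicAlgCl p) = algebraMap ℚ_[p] (PadicAlgCl p) ((m : ℚ) : ℚ_[p]) := by simp
    rw [h2, norm_algebraMap', Padic.eq_padicNorm, padicNorm.eq_zpow_of_nonzero (by exact_mod_cast hm),
      padicValRat.of_int]
    push_cast; rfl
  rw [ordPadic, h1, Real.log_zpow]
  have := (log_prime_pos p).ne'
  push_cast
  field_simp

theorem ordPadic_natCast {m : ℕ} (hm : m ≠ 0) :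
    ordPadic p (m : PadicAlgCl p) = padicValNat p m := by
  have := ordPadic_intCast p (m := m) (by exact_mod_cast hm)
  rwa [padicValInt.of_nat, Int.cast_natCast] at this

theorem norm_natCast_prime : ‖(p : PadicAlgCl p)‖ = (p : ℝ)⁻¹ := by
  have h2 : (p : PadicAlgCl p) = algebraMap ℚ_[p] (PadicAlgCl p) (p : ℚ_[p]) := by simp
  rw [h2, norm_algebraMap', Padic.norm_p]

theorem norm_natCast_of_coprime {m : ℕ} (hm : m.Coprime p) : ‖(m : PadicAlgCl p)‖ = 1 := by
  have h2 : (m : PadicAlgCl p) = algebraMap ℚ_[p] (PadicAlgCl p) (m : ℚ_[p]) := by simp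
  rw [h2, norm_algebraMap', Padic.norm_natCast_eq_one_iff]
  exact hm.symm

end Valuation

/-! ### Teichmüller lifts -/

section TeichmullerRep

variable (p : ℕ) [hp : Fact p.Prime]

theorem teichmullerRep_spec {β : PadicAlgCl p} (hβ : ‖β‖ = 1) :
    ‖β - teichmullerRep p β‖ < 1 ∧ ∃ m : ℕ, m.Coprime p ∧ teichmullerRep p β ^ m = 1 := by
  have hmem : β ∈ padicAlgInt p := (mem_padicAlgInt p).mpr hβ.le
  have hne : IsLocalRing.residue (padicAlgInt p) ⟨β, hmem⟩ ≠ 0 := by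
    rw [Ne, residue_eq_zero_iff_norm]
    simp [hβ]
  have hrep : teichmullerRep p β = ((existsUnique_teichmuller p _ hne).choose : PadicAlgCl p) := by
    rw [teichmullerRep, padicReduction, dif_pos hmem, teichmullerLift, dif_neg hne]
  obtain ⟨⟨h1, m, hm, h2⟩, -⟩ := (existsUnique_teichmuller p _ hne).choose_spec
  rw [hrep]
  refine ⟨?_, m, hm, congrArg Subtype.val h2⟩
  have h3 := (residue_eq_zero_iff_norm p (⟨β, hmem⟩ - (existsUnique_teichmuller p _ hne).choose)).mp
    (by rw [map_sub, h1, sub_self])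
  exact h3

theorem eq_one_of_pow_eq_one_of_coprime {x : PadicAlgCl p} {m : ℕ} (hm : m.Coprime p)
    (hxm : x ^ m = 1) (hx : ‖x - 1‖ < 1) : x = 1 := by
  have := norm_pow_sub_one_eq hx (norm_natCast_of_coprime p hm)
  rw [hxm, sub_self, norm_zero] at this
  exact sub_eq_zero.mp (norm_eq_zero.mp this.symm)

theorem norm_teichmullerRep {β : PadicAlgCl p} (hβ : ‖β‖ = 1) : ‖teichmullerRep p β‖ = 1 := by
  have := (teichmullerRep_spec p hβ).1
  rw [← hβ] at this ⊢
  rw [norm_sub_rev] at this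
  exact norm_eq_of_norm_sub_lt this

theorem norm_div_teichmullerRep_sub_one {β : PadicAlgCl p} (hβ : ‖β‖ = 1) :
    ‖β / teichmullerRep p β - 1‖ = ‖β - teichmullerRep p β‖ := by
  have h := norm_teichmullerRep p hβ
  have h0 : teichmullerRep p β ≠ 0 := by rw [← norm_ne_zero_iff, h]; exact one_ne_zero
  rw [← mul_one ‖β / _ - 1‖, ← h, ← norm_mul, sub_mul, one_mul, div_mul_cancel₀ _ h0]

theorem norm_pow_div_teichmullerRep_sub_one {β : PadicAlgCl p} (hβ : ‖β‖ = 1) (k : ℕ) :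
    ‖(β / teichmullerRep p β) ^ k - 1‖ = ‖β ^ k - teichmullerRep p β ^ k‖ := by
  have h := norm_teichmullerRep p hβ
  have h0 : teichmullerRep p β ≠ 0 := by rw [← norm_ne_zero_iff, h]; exact one_ne_zero
  have h1 : ‖teichmullerRep p β ^ k‖ = 1 := by rw [norm_pow, h, one_pow]
  rw [← mul_one ‖_ - 1‖, ← h1, ← norm_mul, sub_mul, one_mul, div_pow,
    div_mul_cancel₀ _ (pow_ne_zero _ h0)]

/-- The `n`-th power of the lift is congruent to `β^n`, hence to 1, and 1 is the only root of unity
of order prime to `p` in its residue class. -/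
theorem teichmullerRep_pow_eq_one {β : PadicAlgCl p} (hβ : ‖β‖ = 1) {n : ℕ}
    (hn : ‖β ^ n - 1‖ < 1) : teichmullerRep p β ^ n = 1 := by
  obtain ⟨h1, m, hm, hτ⟩ := teichmullerRep_spec p hβ
  refine eq_one_of_pow_eq_one_of_coprime p hm (by rw [← pow_mul, mul_comm, pow_mul, hτ, one_pow]) ?_
  rw [← norm_div_teichmullerRep_sub_one p hβ] at h1
  have h2 := norm_pow_sub_one_lt h1 n
  rw [norm_pow_div_teichmullerRep_sub_one p hβ, norm_sub_rev] at h2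
  have := IsUltrametricDist.norm_add_le_max (teichmullerRep p β ^ n - β ^ n) (β ^ n - 1)
  rw [sub_add_sub_cancel] at this
  exact this.trans_lt (max_lt h2 hn)

/-- The exponent `p^r` divides `n`, so equality would propagate to `β^n = τ^n = 1`. -/
theorem pow_rPadic_ne {β : PadicAlgCl p} (hβ : ‖β‖ = 1) {n : ℕ} (hn : ‖β ^ n - 1‖ < 1)
    (hne : β ^ n ≠ 1) : β ^ p ^ rPadic p n β ≠ teichmullerRep p β ^ p ^ rPadic p n β := by
  intro h
  obtain ⟨q, hq⟩ : p ^ rPadic p n β ∣ n := (pow_dvd_pow p (min_le_left _ _)).trans pow_padicValNat_dvd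
  apply hne
  rw [← teichmullerRep_pow_eq_one p hβ hn]
  conv_lhs => rw [hq]
  conv_rhs => rw [hq]
  rw [pow_mul, h, ← pow_mul]

/-- The valuation of `β ^ n - 1` for a unit `β` with `β ^ n` congruent to `1`. -/
theorem ordPadic_pow_sub_one {β : PadicAlgCl p} (hβ : ‖β‖ = 1) {n : ℕ} (hn0 : n ≠ 0)
    (hn : ‖β ^ n - 1‖ < 1) (hne : β ^ n ≠ 1) :
    ordPadic p (β ^ n - 1) = padicValNat p n +
      (ordPadic p (β ^ p ^ rPadic p n β - teichmullerRep p β ^ p ^ rPadic p n β) -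
        rPadic p n β) := by
  set τ := teichmullerRep p β with hτ
  set u := β / τ with hu
  have hu1 : ‖u - 1‖ < 1 := by
    rw [norm_div_teichmullerRep_sub_one p hβ]; exact (teichmullerRep_spec p hβ).1
  set k := padicValNat p n with hk
  have hτn : τ ^ n = 1 := teichmullerRep_pow_eq_one p hβ hn
  have hun : u ^ n = β ^ n := by rw [hu, div_pow, hτn, div_one]
  -- removing the part of `n` prime to `p`
  have h1 : ‖β ^ n - 1‖ = ‖u ^ p ^ k - 1‖ := by
    obtain ⟨m, hm⟩ : p ^ k ∣ n := pow_padicValNat_dvd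
    have hmp : m.Coprime p := by
      refine (Nat.Coprime.symm ((Nat.Prime.coprime_iff_not_dvd hp.out).mpr fun hd => ?_))
      refine pow_succ_padicValNat_not_dvd (p := p) hn0 ?_
      conv_rhs => rw [hm]
      rw [pow_succ]
      exact mul_dvd_mul_left _ hd
    rw [← hun]
    conv_lhs => rw [hm, pow_mul]
    exact norm_pow_sub_one_eq (norm_pow_sub_one_lt hu1 _) (norm_natCast_of_coprime p hmp)
  have h2 : ‖u ^ p ^ k - 1‖ = ‖(p : PadicAlgCl p)‖ ^ (k - rPadic p n β) *
      ‖u ^ p ^ rPadic p n β - 1‖ := by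
    -- If `k ≤ s` then `r = k` and no power is left over. Otherwise `r = s`, and each of the other
    -- `k - s` powers contributes a factor `‖p‖`.
    rcases le_total k (sPadic p β) with hle | hle
    · rw [rPadic, ← hk, min_eq_left hle, Nat.sub_self, pow_zero, one_mul]
    · have hr : rPadic p n β = sPadic p β := min_eq_right hle
      rw [hr]
      -- Since `β^n ≠ 1`, `β` differs from its lift. This is needed because `ordPadic p 0 = 0`,
      -- which would leave the set defining `sPadic` empty.
      have hx0 : 0 < ‖u - 1‖ := by
        rw [norm_pos_iff, sub_ne_zero]
        intro h
        apply hne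
        rw [← hun, h, one_pow]
      have hp1 : (1 : ℝ) < p := by exact_mod_cast hp.out.one_lt
      have hlog := log_prime_pos p
      have hord : 0 < ordPadic p (β - τ) := by
        rw [ordPadic, ← norm_div_teichmullerRep_sub_one p hβ]
        exact div_pos (neg_pos.mpr (Real.log_neg hx0 hu1)) hlog
      have hset : ({s : ℕ | 1 < (p : ℝ) ^ s * ((p : ℝ) - 1) * ordPadic p (β - τ)}).Nonempty := by
        have hc : 0 < ((p : ℝ) - 1) * ordPadic p (β - τ) := mul_pos (by linarith) hord
        obtain ⟨s, hs⟩ := pow_unbounded_of_one_lt (((p : ℝ) - 1) * ordPadic p (β - τ))⁻¹ hp1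
        refine ⟨s, ?_⟩
        rw [Set.mem_ofPred_eq, mul_assoc]
        rwa [inv_lt_iff_one_lt_mul₀ hc] at hs
      have hs : 1 < (p : ℝ) ^ sPadic p β * ((p : ℝ) - 1) * ordPadic p (β - τ) := Nat.sInf_mem hset
      -- The inequality defining `sPadic`, exponentiated.
      have hcond : ‖u - 1‖ ^ (p ^ sPadic p β * (p - 1)) < ‖(p : PadicAlgCl p)‖ := by
        rw [norm_natCast_prime, ← Real.log_lt_log_iff (by positivity) (by positivity), Real.log_pow,
          Real.log_inv]
        rw [ordPadic, ← norm_div_teichmullerRep_sub_one p hβ, ← hτ, ← hu, ← mul_div_assoc,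
          lt_div_iff₀ hlog] at hs
        push_cast [Nat.cast_sub hp.out.one_le]
        linarith
      have := norm_pow_prime_pow_add_sub_one_eq hp.out (sPadic p β) (k - sPadic p β) hu1 hcond
      rwa [Nat.add_sub_cancel' hle] at this
  rw [show ‖u ^ p ^ rPadic p n β - 1‖ = _ from norm_pow_div_teichmullerRep_sub_one p hβ _] at h2
  have hrk : rPadic p n β ≤ k := min_le_left _ _
  have hp0 : (p : PadicAlgCl p) ≠ 0 := Nat.cast_ne_zero.mpr hp.out.ne_zero
  have h3 : ordPadic p (β ^ n - 1) = ordPadic p ((p : PadicAlgCl p) ^ (k - rPadic p n β) *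
      (β ^ p ^ rPadic p n β - τ ^ p ^ rPadic p n β)) :=
    ordPadic_congr p (by
      rw [h1, norm_mul, norm_pow, h2])
  rw [h3, ordPadic_mul p (pow_ne_zero _ hp0) (sub_ne_zero.mpr (pow_rPadic_ne p hβ hn hne)),
    ← Nat.cast_pow, ordPadic_natCast p (pow_ne_zero _ hp.out.ne_zero), padicValNat.prime_pow,
    Nat.cast_sub hrk]
  ring

end TeichmullerRep

/-! ### Products over roots of unity -/

section RootsOfUnityProducts

variable {K : Type*} [Field K] {n : ℕ} [NeZero n]

theorem exists_isPrimitive_prod_X_sub_C (K : Type*) [Field K] [IsAlgClosed K] [CharZero K] (n : ℕ)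
    [NeZero n] : ∃ ψ : AddChar (ZMod n) K, ψ.IsPrimitive ∧
      ∏ j, (Polynomial.X - Polynomial.C (ψ j)) = Polynomial.X ^ n - 1 := by
  obtain ⟨ζ, hζ⟩ := HasEnoughRootsOfUnity.exists_primitiveRoot K n
  refine ⟨_, AddChar.zmodChar_primitive_of_primitive_root n hζ, ?_⟩
  have h := X_pow_sub_C_eq_prod hζ (NeZero.pos n) (one_pow n)
  rw [Polynomial.C_1] at h
  rw [h]
  refine Finset.prod_bij' (fun j _ => j.val) (fun i _ => (i : ZMod n)) ?_ ?_ ?_ ?_ ?_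
  · intro j _; exact Finset.mem_range.mpr (ZMod.val_lt j)
  · intro i _; exact Finset.mem_univ _
  · intro j _; exact ZMod.natCast_zmod_val j
  · intro i hi; exact ZMod.val_cast_of_lt (Finset.mem_range.mp hi)
  · intro j _; rw [AddChar.zmodChar_apply, mul_one]

theorem prod_sub_addChar {ψ : AddChar (ZMod n) K}
    (hψ : ∏ j, (Polynomial.X - Polynomial.C (ψ j)) = Polynomial.X ^ n - 1) (x : K) :
    ∏ j, (x - ψ j) = x ^ n - 1 := by
  simpa [Polynomial.eval_prod] using congrArg (Polynomial.eval x) hψ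

/-- Evaluate `(X^n - 1) / (X - 1) = 1 + X + ... + X^(n-1)` at 1. -/
theorem prod_one_sub_addChar {ψ : AddChar (ZMod n) K}
    (hψ : ∏ j, (Polynomial.X - Polynomial.C (ψ j)) = Polynomial.X ^ n - 1) :
    ∏ j ∈ Finset.univ.erase 0, (1 - ψ j) = n := by
  rw [← Finset.mul_prod_erase _ _ (Finset.mem_univ 0), AddChar.map_zero_eq_one, Polynomial.C_1,
    ← mul_geom_sum] at hψ
  have := mul_left_cancel₀ (by simpa using Polynomial.X_sub_C_ne_zero (1 : K)) hψ
  simpa [Polynomial.eval_prod, Polynomial.eval_geom_sum] using congrArg (Polynomial.eval 1) this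

/-- The norm of `∏ f(ζ)` over the `n`-th roots of unity, in terms of the roots of `f`. -/
theorem norm_prod_eval_addChar {K : Type*} [NormedField K] [IsAlgClosed K] {n : ℕ} [NeZero n]
    {ψ : AddChar (ZMod n) K}
    (hψ : ∏ j, (Polynomial.X - Polynomial.C (ψ j)) = Polynomial.X ^ n - 1) (f : Polynomial K) :
    ‖∏ j, f.eval (ψ j)‖ = ‖f.leadingCoeff‖ ^ n * (f.roots.map fun β => ‖β ^ n - 1‖).prod := by
  have h1 : ∀ j, ‖f.eval (ψ j)‖ = ‖f.leadingCoeff‖ * (f.roots.map fun β => ‖β - ψ j‖).prod := by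
    intro j
    rw [(IsAlgClosed.splits f).eval_eq_prod_roots, norm_mul]
    congr 1
    generalize f.roots = s
    induction s using Multiset.induction_on with
    | empty => simp
    | cons a s ih => simp [ih, norm_sub_rev]
  -- Exchanging the products over characters and over roots leaves `∏ j, (β - ψ j) = β^n - 1` for
  -- each root `β`.
  rw [norm_prod, Finset.prod_congr rfl fun j _ => h1 j, Finset.prod_mul_distrib, Finset.prod_const,
    Finset.card_univ, ZMod.card, ← Multiset.prod_map_prod]
  congr 3
  funext β
  rw [← norm_prod, prod_sub_addChar hψ]

end RootsOfUnityProducts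

/-! ### The Ihara polynomial -/

theorem clearPole_ne_zero {f : LaurentPolynomial ℤ} (hf : f ≠ 0) : clearPole f ≠ 0 := by
  intro h
  have := toLaurent_clearPole f
  rw [h, map_zero] at this
  have h2 := congrArg (LaurentPolynomial.T (ordAtZero f) * ·) this
  simp only [mul_zero, ← mul_assoc, ← LaurentPolynomial.T_add, add_neg_cancel,
    LaurentPolynomial.T_zero, one_mul] at h2
  exact hf h2.symm

theorem eval_one_removeZeros_ne_zero {f : LaurentPolynomial ℤ} (hf : f ≠ 0) :
    (removeZeros f).eval 1 ≠ 0 :=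
  Polynomial.eval_divByMonic_pow_rootMultiplicity_ne_zero 1 (clearPole_ne_zero hf)

theorem norm_eval₂_of_norm_eq_one {K : Type*} [NormedField K] (f : LaurentPolynomial ℤ) (u : Kˣ)
    (hu : ‖(u : K)‖ = 1) : ‖LaurentPolynomial.eval₂ (Int.castRingHom K) u f‖ =
      ‖1 - (u : K)‖ ^ ordAtOne f * ‖(removeZeros f).eval₂ (Int.castRingHom K) (u : K)‖ := by
  have h := congrArg (fun g => ‖LaurentPolynomial.eval₂ (Int.castRingHom K) u g‖)
    (toLaurent_removeZeros f)
  simp only [map_mul, map_pow, map_sub, map_one, LaurentPolynomial.eval₂_T,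
    LaurentPolynomial.eval₂_toLaurent, norm_mul, norm_pow, zpow_one] at h
  rw [Units.val_zpow_eq_zpow_val, norm_zpow, hu, one_zpow, one_mul] at h
  rw [← h, norm_sub_rev 1 (u : K)]

theorem pierceLehmer_one (f : Polynomial ℤ) :
    pierceLehmer f 1 = (-1) ^ f.natDegree * f.eval 1 := by
  have h1 : (Polynomial.X ^ 1 - 1 : Polynomial ℤ) = Polynomial.X - Polynomial.C 1 := by simp
  rw [pierceLehmer, h1, Polynomial.natDegree_X_sub_C,
    Polynomial.resultant_X_sub_C_right _ _ _ le_rfl]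

/-! ### Absolute values of tree numbers and the contributions of the roots of `J` -/

namespace VoltageAssignment

variable {V E : Type*} {X : SerreGraph V E} [Fintype V] [DecidableEq V] [Fintype E]

/-- The double cover is connected, so it has spanning trees; their number has a value of the Ihara
polynomial at a nontrivial character as a factor. -/
theorem ihara_ne_zero [Nonempty V] (α : VoltageAssignment X ℤ) (hα : α.derived.Connected) :
    α.ihara ≠ 0 := by
  intro h
  obtain ⟨ψ, hψ, -⟩ := exists_isPrimitive_prod_X_sub_C (AlgebraicClosure ℚ) 2
  have h2 := α.natCast_mul_numSpanningTrees_level 2 hψ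
  have h1 : (1 : ZMod 2) ∈ Finset.univ.erase (0 : ZMod 2) := by simp
  rw [Finset.prod_eq_zero h1 (by rw [h, map_zero]), mul_zero] at h2
  have h3 := (α.level_connected hα 2).numSpanningTrees_ne_zero
  simp [h3] at h2

/-- The norm form of the formula for the number of spanning trees in a cyclic cover. -/
theorem norm_numSpanningTrees_level [Nonempty V] (α : VoltageAssignment X ℤ) (p : ℕ)
    [Fact p.Prime] (n : ℕ) [NeZero n] :
    ‖(n : PadicAlgCl p)‖ * ‖((α.level n).numSpanningTrees : PadicAlgCl p)‖ *
        ‖((α.J.eval 1 : ℤ) : PadicAlgCl p)‖ =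
      ‖(X.numSpanningTrees : PadicAlgCl p)‖ * ‖(n : PadicAlgCl p)‖ ^ ordAtOne α.ihara *
        (‖(α.J.map (algebraMap ℤ (PadicAlgCl p))).leadingCoeff‖ ^ n *
          ((α.J.aroots (PadicAlgCl p)).map fun β => ‖β ^ n - 1‖).prod) := by
  obtain ⟨ψ, hψ, hprod⟩ := exists_isPrimitive_prod_X_sub_C (PadicAlgCl p) n
  have h1 := congrArg norm (α.natCast_mul_numSpanningTrees_level n hψ)
  have hnorm : ∀ j, ‖ψ j‖ = 1 := by
    intro j
    have h2 : ψ j ^ n = 1 := by rw [← AddChar.map_nsmul_eq_pow]; simp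
    have h3 := congrArg norm h2
    rw [norm_pow, norm_one] at h3
    exact (pow_eq_one_iff_of_nonneg (norm_nonneg _) (NeZero.ne n)).mp h3
  rw [norm_mul, norm_mul, norm_prod] at h1
  -- The factor `J(1)` on the left is the missing `j = 0` term of the product over all characters on
  -- the right.
  rw [h1, ← norm_prod_eval_addChar hprod, Finset.prod_congr rfl fun j _ =>
    norm_eval₂_of_norm_eq_one α.ihara (charUnit ψ j) (hnorm j), Finset.prod_mul_distrib,
    Finset.prod_pow, ← Finset.mul_prod_erase _ _ (Finset.mem_univ 0), norm_mul, norm_prod]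
  have h4 : ∏ j ∈ Finset.univ.erase 0, ‖1 - (charUnit ψ j : PadicAlgCl p)‖ =
      ‖(n : PadicAlgCl p)‖ := by
    rw [← norm_prod, ← prod_one_sub_addChar hprod]; rfl
  have h5 : (α.J.map (algebraMap ℤ (PadicAlgCl p))).eval (ψ 0) =
      ((α.J.eval 1 : ℤ) : PadicAlgCl p) := by
    rw [AddChar.map_zero_eq_one, Polynomial.eval_one_map]; rfl
  have h6 : ∏ j ∈ Finset.univ.erase 0,
      ‖(removeZeros α.ihara).eval₂ (Int.castRingHom (PadicAlgCl p)) (charUnit ψ j)‖ =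
      ∏ j ∈ Finset.univ.erase 0, ‖(α.J.map (algebraMap ℤ (PadicAlgCl p))).eval (ψ j)‖ :=
    Finset.prod_congr rfl fun j _ => by
      rw [Polynomial.eval_map, RingHom.ext_int (algebraMap ℤ (PadicAlgCl p)) (Int.castRingHom _)]; rfl
  rw [h4, h5, h6]
  ring

/-- `J` already splits over the algebraic closure of `ℚ_p`, so passing to `ℂ_p` adds no roots, and
it preserves the norm. -/
theorem logPadicMahler_J (α : VoltageAssignment X ℤ) (p : ℕ) [Fact p.Prime] (hJ : α.J ≠ 0) :
    logPadicMahler p (α.J.map (Int.castRingHom ℂ_[p])) =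
      Real.log ‖(α.J.map (algebraMap ℤ (PadicAlgCl p))).leadingCoeff‖ +
        ((α.J.aroots (PadicAlgCl p)).map fun β => Real.log (max 1 ‖β‖)).sum := by
  set g := α.J.map (algebraMap ℤ (PadicAlgCl p)) with hg
  have hg0 : g ≠ 0 := (Polynomial.map_ne_zero_iff
    (RingHom.injective_int (algebraMap ℤ (PadicAlgCl p)))).mpr hJ
  have hmap : α.J.map (Int.castRingHom ℂ_[p]) = g.map (algebraMap (PadicAlgCl p) ℂ_[p]) := by
    rw [hg, Polynomial.map_map]
    congr 1
    exact RingHom.ext_int _ _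
  have hroots : α.J.aroots (PadicAlgCl p) = g.roots := rfl
  have hnorm : ∀ x : PadicAlgCl p, ‖algebraMap (PadicAlgCl p) ℂ_[p] x‖ = ‖x‖ :=
    PadicComplex.norm_extends p
  rw [logPadicMahler, padicMahler, hmap, Polynomial.leadingCoeff_map,
    (IsAlgClosed.splits g).roots_map, Multiset.map_map, hnorm, hroots]
  simp only [Function.comp_def, hnorm]
  have key : ∀ s : Multiset (PadicAlgCl p), (s.map fun β => max 1 ‖β‖).prod ≠ 0 ∧
      Real.log (s.map fun β => max 1 ‖β‖).prod = (s.map fun β => Real.log (max 1 ‖β‖)).sum := by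
    intro s
    induction s using Multiset.induction_on with
    | empty => simp
    | cons a s ih =>
      have ha : max 1 ‖a‖ ≠ 0 := (zero_lt_one.trans_le (le_max_left _ _)).ne'
      rw [Multiset.map_cons, Multiset.prod_cons, Multiset.map_cons, Multiset.sum_cons, ← ih.2]
      exact ⟨mul_ne_zero ha ih.1, Real.log_mul ha ih.1⟩
  rw [Real.log_mul (norm_ne_zero_iff.mpr (Polynomial.leadingCoeff_ne_zero.mpr hg0)) (key _).1,
    (key _).2]

open Classical in
/-- The contribution of one root of `J` to the valuation. -/
theorem log_norm_pow_sub_one (α : VoltageAssignment X ℤ) (p : ℕ) [Fact p.Prime] {n : ℕ}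
    (hn : n ≠ 0) {β : PadicAlgCl p} (hroot : Polynomial.aeval β α.J = 0) (hne : β ^ n ≠ 1) :
    Real.log ‖β ^ n - 1‖ = n * Real.log (max 1 ‖β‖) - Real.log p *
      (if β ∈ α.B p n then (padicValNat p n : ℝ) +
        (ordPadic p (β ^ p ^ rPadic p n β - teichmullerRep p β ^ p ^ rPadic p n β) -
          rPadic p n β) else 0) := by
  -- Off the unit circle the larger of `β^n` and 1 gives the norm of the difference. On it the norm
  -- is 1 unless `β` lies in `B`.
  rcases lt_trichotomy ‖β‖ 1 with h | h | h
  · have h1 : ‖β ^ n - 1‖ = 1 := by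
      rw [norm_sub_rev]
      have : ‖(1 - β ^ n) - 1‖ < ‖(1 : PadicAlgCl p)‖ := by
        rw [sub_sub_cancel_left, norm_neg, norm_pow, norm_one]
        exact pow_lt_one₀ (norm_nonneg _) h hn
      rw [norm_eq_of_norm_sub_lt this, norm_one]
    rw [if_neg (fun hB => h.ne hB.2.1), h1, max_eq_left h.le]
    simp
  · rw [h, max_self, Real.log_one, mul_zero, zero_sub]
    have hlog := (log_prime_pos p).ne'
    split_ifs with hB
    · rw [← ordPadic_pow_sub_one p h hn hB.2.2 hne, ordPadic]
      field_simp
    · have h1 : ‖β ^ n - 1‖ = 1 := by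
        refine le_antisymm ?_ (not_lt.mp fun hlt => hB ⟨hroot, h, hlt⟩)
        have := IsUltrametricDist.norm_add_le_max (β ^ n) (-1)
        rwa [← sub_eq_add_neg, norm_neg, norm_pow, h, one_pow, norm_one, max_self] at this
      rw [h1]; simp
  · have h1 : ‖β ^ n - 1‖ = ‖β‖ ^ n := by
      rw [← norm_pow]
      refine norm_eq_of_norm_sub_lt ?_
      rw [sub_sub_cancel_left, norm_neg, norm_one, norm_pow]
      exact one_lt_pow₀ h hn
    rw [if_neg (fun hB => h.ne' hB.2.1), h1, max_eq_right h.le, Real.log_pow]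
    ring

theorem sum_log_norm_pow_sub_one (α : VoltageAssignment X ℤ) (p : ℕ) [Fact p.Prime] {n : ℕ}
    (hn : n ≠ 0) (h : ∀ β ∈ α.J.aroots (PadicAlgCl p), β ^ n ≠ 1) :
    Real.log ((α.J.aroots (PadicAlgCl p)).map fun β => ‖β ^ n - 1‖).prod =
      n * ((α.J.aroots (PadicAlgCl p)).map fun β => Real.log (max 1 ‖β‖)).sum -
        Real.log p * ((α.rootsB p n).card * padicValNat p n + α.nu p n) := by
  classical
  have hroot : ∀ β ∈ α.J.aroots (PadicAlgCl p), Polynomial.aeval β α.J = 0 :=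
    fun β hβ => (Polynomial.mem_aroots'.mp hβ).2
  rw [nu, rootsB]
  -- The induction runs over arbitrary multisets of roots, while the set `B` used for filtering
  -- stays that of `J`.
  generalize α.J.aroots (PadicAlgCl p) = s at h hroot
  induction s using Multiset.induction_on with
  | empty => simp
  | cons a s ih =>
    have ih' := ih (fun β hβ => h β (Multiset.mem_cons_of_mem hβ))
      fun β hβ => hroot β (Multiset.mem_cons_of_mem hβ)
    have ha := h a (Multiset.mem_cons_self a s)
    have hprod : (s.map fun β => ‖β ^ n - 1‖).prod ≠ 0 := by
      refine Multiset.prod_ne_zero fun h0 => ?_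
      obtain ⟨β, hβ, hβ0⟩ := Multiset.mem_map.mp h0
      exact h β (Multiset.mem_cons_of_mem hβ) (sub_eq_zero.mp (norm_eq_zero.mp hβ0))
    rw [Multiset.map_cons, Multiset.prod_cons, Real.log_mul (norm_ne_zero_iff.mpr
      (sub_ne_zero.mpr ha)) hprod, ih', α.log_norm_pow_sub_one p hn
      (hroot a (Multiset.mem_cons_self a s)) ha, Multiset.map_cons, Multiset.sum_cons]
    by_cases hB : a ∈ α.B p n
    · rw [if_pos hB, Multiset.filter_cons_of_pos _ hB, Multiset.card_cons, Multiset.map_cons,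
        Multiset.sum_cons]
      push_cast
      ring
    · rw [if_neg hB, Multiset.filter_cons_of_neg _ hB]
      ring

end VoltageAssignment

theorem theorem3 {V E : Type*} [Fintype V] [DecidableEq V] [Fintype E]
    (X : SerreGraph V E) (hX : X.Connected) (hχ : X.eulerChar ≠ 0)
    (α : VoltageAssignment X ℤ) (hα : α.derived.Connected)
    (p : ℕ) [Fact p.Prime] :
    X.numSpanningTrees ≠ 0 ∧ pierceLehmer α.J 1 ≠ 0 ∧
    ∀ n : ℕ, 0 < n →
      (α.level n).numSpanningTrees ≠ 0 ∧
      (∀ β ∈ α.B p n,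
        β ^ p ^ rPadic p n β ≠ teichmullerRep p β ^ p ^ rPadic p n β) ∧
      (padicValNat p (α.level n).numSpanningTrees : ℝ) =
        α.mu p * (n : ℝ) + (α.lam p n : ℝ) * (padicValNat p n : ℝ) + α.nu p n + α.c p := by
  have : Nonempty V := hX.1
  have hκ : X.numSpanningTrees ≠ 0 := hX.numSpanningTrees_ne_zero
  have hJ1 : α.J.eval 1 ≠ 0 := eval_one_removeZeros_ne_zero (α.ihara_ne_zero hα)
  have hJ : α.J ≠ 0 := fun h => hJ1 (by rw [h, Polynomial.eval_zero])
  have hΔ : pierceLehmer α.J 1 ≠ 0 := by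
    rw [pierceLehmer_one]
    exact mul_ne_zero (pow_ne_zero _ (by norm_num)) hJ1
  refine ⟨hκ, hΔ, fun n hn => ?_⟩
  have : NeZero n := ⟨hn.ne'⟩
  have hκn : (α.level n).numSpanningTrees ≠ 0 := (α.level_connected hα n).numSpanningTrees_ne_zero
  have hnorm := α.norm_numSpanningTrees_level p n
  have hn0 : ‖(n : PadicAlgCl p)‖ ≠ 0 := norm_ne_zero_iff.mpr (Nat.cast_ne_zero.mpr hn.ne')
  have hκ0 : ‖(X.numSpanningTrees : PadicAlgCl p)‖ ≠ 0 :=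
    norm_ne_zero_iff.mpr (Nat.cast_ne_zero.mpr hκ)
  have hκn0 : ‖((α.level n).numSpanningTrees : PadicAlgCl p)‖ ≠ 0 :=
    norm_ne_zero_iff.mpr (Nat.cast_ne_zero.mpr hκn)
  have hJ0 : ‖((α.J.eval 1 : ℤ) : PadicAlgCl p)‖ ≠ 0 :=
    norm_ne_zero_iff.mpr (Int.cast_ne_zero.mpr hJ1)
  -- The left side of the norm identity is nonzero, hence so is every factor on the right; in
  -- particular no root of `J` is an `n`-th root of unity.
  have hL := mul_ne_zero (mul_ne_zero hn0 hκn0) hJ0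
  rw [hnorm] at hL
  have hlc := left_ne_zero_of_mul (right_ne_zero_of_mul hL)
  have hpr := right_ne_zero_of_mul (right_ne_zero_of_mul hL)
  have hroots : ∀ β ∈ α.J.aroots (PadicAlgCl p), β ^ n ≠ 1 := by
    intro β hβ h1
    refine hpr (Multiset.prod_eq_zero (Multiset.mem_map.mpr ⟨β, hβ, ?_⟩))
    rw [h1, sub_self, norm_zero]
  refine ⟨hκn, fun β hβ => ?_, ?_⟩
  · refine pow_rPadic_ne p hβ.2.1 hβ.2.2 (hroots β ?_)
    rw [Polynomial.mem_aroots]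
    exact ⟨hJ, hβ.1⟩
  have hlog := congrArg Real.log hnorm
  rw [Real.log_mul (mul_ne_zero hn0 hκn0) hJ0, Real.log_mul hn0 hκn0,
    Real.log_mul (left_ne_zero_of_mul hL) (right_ne_zero_of_mul hL),
    Real.log_mul hκ0 (pow_ne_zero _ hn0), Real.log_mul hlc hpr, Real.log_pow, Real.log_pow,
    α.sum_log_norm_pow_sub_one p hn.ne' hroots] at hlog
  have hp0 := (log_prime_pos p).ne'
  -- The resultant with `t - 1` is `J(1)` up to sign.
  have hΔv : padicValInt p (pierceLehmer α.J 1) = padicValInt p (α.J.eval 1) := by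
    rw [pierceLehmer_one, padicValInt, padicValInt, Int.natAbs_mul, Int.natAbs_pow]
    simp
  have e1 := ordPadic_natCast p hn.ne'
  have e2 := ordPadic_natCast p hκ
  have e3 := ordPadic_natCast p hκn
  have e4 := ordPadic_intCast p hJ1
  rw [ordPadic, div_eq_iff hp0, neg_eq_iff_eq_neg] at e1 e2 e3 e4
  rw [VoltageAssignment.mu, VoltageAssignment.lam, VoltageAssignment.c, α.logPadicMahler_J p hJ, hΔv]
  rw [e1, e2, e3, e4] at hlog
  field_simp
  push_cast
  linear_combination -hlog
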